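/- **Notation.** Fix $\tau\in\mathbb C$ with $\operatorname{im}\tau>0$ and integers $m,r\ge 0$; put $q=e^{2\pi i\tau}$, $q^{1/2}=e^{\pi i\tau}$. Consider meromorphic functions $f$ on $\mathbb C^{m+r+2}$ with (additive) coordinates $x_1,\dots,x_m,u,h,\mu_1,\dots,\mu_r$. Let $$\theta(x)=2q^{1/8}\sin(\pi x)\prod_{n\ge1}(1-q^n)(1-q^ne^{2\pi ix})(1-q^ne^{-2\pi ix}),\qquad F(x,y)=\frac{\theta'(0)\,\theta(x+y)}{\theta(x)\,\theta(y)}$$ (so $F(x,y)=\delta(e^{2\pi i x},e^{2\pi i y})$ in multiplicative notation). For a quadratic form $Q(z)=\frac12 z^TAz$ with $A$ a symmetric integral matrix, $f$ is *pure of type* $Q$ if for all integral vectors $k,\ell$ $$f(z+k+\ell\tau)=(-1)^{k^TAk}(-q^{-1/2})^{\ell^TA\ell}e^{-2\pi i\,\ell^TAz}f(z);$$ for $f\ne0$ the form $Q=\operatorname{type}(f)$ is unique. The group $\mathfrak S_m$ permutes the $x_i$ by $w(x_i)=x_{w(i)}$; $s_i$ is the transposition of $i$ and $i+1$, and $\partial_iQ=(Q-s_iQ)/(x_i-x_{i+1})$.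 For an integral linear form $\nu$ in $u,h,\mu_1,\dots,\mu_r$ with $\nu+h\ne0$ put $$\overline{\mathfrak C}{}_i^{\nu}(f)=\frac1{F(\nu,h)}\Big(F(x_{i+1}-x_i,\nu)\,f+F(x_i-x_{i+1},h)\,s_if\Big),$$ extended by continuity to $\overline{\mathfrak C}{}_i^{0}=\mathrm{id}$. Let $\rho_m=-\sum_{i=1}^m i\,x_i$ and $\phi_w\big(\sum_i\alpha_ix_i\big)=\sum_{i<j,\;w(i)>w(j)}(\alpha_i-\alpha_j)$. **Theorem.** Let $f$ be pure of type $Q$, and let $s_{i_1}s_{i_2}\cdots s_{i_\ell}$ be a word, not necessarily reduced, presenting $w\in\mathfrak S_m$. Put $f_\ell=f$, $Q_\ell=Q$, and for $k=\ell,\ell-1,\dots,1$ $$\nu_k=\partial_{i_k}Q_k-h,\qquad f_{k-1}=\overline{\mathfrak C}{}_{i_k}^{\nu_k}(f_k),\qquad Q_{k-1}=Q_k+(x_{i_k+1}-x_{i_k})\nu_k-\nu_kh$$ ($Q_{k-1}$ is the type of the first of the two summands of $f_{k-1}$). Assume that the operations are defined: each $\nu_k$ is a linear form in $u,h,\mu_1,\dots,\mu_r$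 not involving the $x_i$, and $\nu_k+h\neq0$. Then: 1. Each $f_k$ is pure of type $Q_k$, and this is its only type if $f_k\ne0$; thus $\nu_k=\partial_{i_k}\operatorname{type}(f_k)-h$ is the parameter forced by purity. 2. The function $\overline{\mathfrak C}{}_w^\diamond(f):=f_0=\overline{\mathfrak C}{}_{i_1}^{\nu_1}\cdots\overline{\mathfrak C}{}_{i_\ell}^{\nu_\ell}(f)$ does not depend on the presentation of $w$: any two words presenting $w$ for which the operations are defined give the same meromorphic function. 3. Suppose $Q=q_x+\rho_mh+q_\mu$ with $q_x=\sum_{i=1}^m\alpha_ix_i$, where the $\alpha_i$ and $q_\mu$ do not involve the variables $x_i$. Then no $\nu_k$ involves the variables $x_i$ (so only $\nu_k+h\ne0$ has to be assumed), and $\overline{\mathfrak C}{}_w^\diamond(f)$ is pure of type $$Q_0=w(q_x)+\rho_mh+q_\mu-\phi_w(q_x)\,h .$$ -/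

import Mathlib

noncomputable section

namespace EllipticDemazure

open scoped BigOperators Topology

/-! ## Variables, functions, equality of meromorphic functions -/

/-- The variables that the permutations do not move: `u`, `h` and `μ_1, …, μ_r`. -/
inductive Par (r : ℕ) : Type
  | u : Par r
  | h : Par r
  | mu (j : Fin r) : Par r
  deriving DecidableEq, Fintype

/-- All the variables: `Sum.inl i` is the variable `x_i`, `Sum.inr p` is `u`, `h` or a `μ_j`. -/
abbrev Var (m r : ℕ) : Type := Fin m ⊕ Par r

/-- Points of `ℂ^(m+r+2)`; the coordinates are written additively, the corresponding point of
`(ℂ^*)^(m+r+2)` is obtained by applying `t ↦ exp (2πi t)` to each of them. -/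
abbrev Pt (m r : ℕ) : Type := Var m r → ℂ

/-- Functions on `ℂ^(m+r+2)`. Values at poles are irrelevant: two meromorphic functions are
regarded as equal when they are related by `GenericEq`. -/
abbrev Fun (m r : ℕ) : Type := Pt m r → ℂ

variable {m r : ℕ}

/-- Equality on a dense open set; for meromorphic functions, equality as meromorphic functions. -/
def GenericEq (f g : Fun m r) : Prop :=
  ∃ U : Set (Pt m r), IsOpen U ∧ Dense U ∧ Set.EqOn f g U

/-- Meromorphic functions of several variables: locally a quotient `p / q` of holomorphic
functions, where `q` does not vanish identically near the given point. -/
def IsMero (f : Fun m r) : Prop :=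
  ∀ z : Pt m r, ∃ p q : Fun m r, AnalyticAt ℂ p z ∧ AnalyticAt ℂ q z ∧
    (¬ ∀ᶠ y in 𝓝 z, q y = 0) ∧ ∀ᶠ y in 𝓝 z, q y ≠ 0 → f y = p y / q y

/-! ## Theta functions -/

/-- `θ_τ(x) = 2 q^(1/8) sin(πx) ∏_{n ≥ 1} (1 - q^n)(1 - q^n e^(2πix))(1 - q^n e^(-2πix))`,
with `q = e^(2πiτ)`. -/
def theta (τ x : ℂ) : ℂ :=
  2 * Complex.exp (2 * Real.pi * Complex.I * τ / 8) * Complex.sin (Real.pi * x) *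
    ∏' n : ℕ,
      ((1 - Complex.exp (2 * Real.pi * Complex.I * τ) ^ (n + 1)) *
        (1 - Complex.exp (2 * Real.pi * Complex.I * τ) ^ (n + 1) *
          Complex.exp (2 * Real.pi * Complex.I * x)) *
        (1 - Complex.exp (2 * Real.pi * Complex.I * τ) ^ (n + 1) /
          Complex.exp (2 * Real.pi * Complex.I * x)))

/-- `F_τ(x, y) = θ'(0) θ(x + y) / (θ(x) θ(y))`, that is `δ(e^(2πix), e^(2πiy))`. -/
def delta (τ x y : ℂ) : ℂ :=
  deriv (theta τ) 0 * theta τ (x + y) / (theta τ x * theta τ y)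

/-! ## Quadratic forms and types -/

/-- Polynomials in the variables; types are quadratic forms, characters are linear forms. -/
abbrev Form (m r : ℕ) : Type := MvPolynomial (Var m r) ℚ

/-- The coordinate `x_i` as a linear form. -/
abbrev X_ (i : Fin m) : Form m r := MvPolynomial.X (Sum.inl i)

/-- The coordinate `h` as a linear form. -/
abbrev h_ : Form m r := MvPolynomial.X (Sum.inr Par.h)

/-- A polynomial in `u, h, μ_1, …, μ_r` regarded as a polynomial in all the variables. -/
def ofPar (p : MvPolynomial (Par r) ℚ) : Form m r := MvPolynomial.rename Sum.inr p

/-- The value at `z` of a linear form. -/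
def ev (p : Form m r) (z : Pt m r) : ℂ := MvPolynomial.aeval z p

/-- The quadratic form `½ ∑ A_ab z_a z_b` of an integral matrix `A`. -/
def quadForm (A : Matrix (Var m r) (Var m r) ℤ) : Form m r :=
  MvPolynomial.C (1 / 2) *
    ∑ a, ∑ b, MvPolynomial.C (A a b : ℚ) * MvPolynomial.X a * MvPolynomial.X b

/-- `f` is a meromorphic section of the line bundle on the power of the elliptic curve
`ℂ / ⟨1, τ⟩` given by the quadratic form `Q = ½ zᵀ A z`, with `A` symmetric and integral:
`f(z + k + ℓ τ) = (-1)^(k·k) (-q^(-1/2))^(ℓ·ℓ) e^(-2πi ℓ·z) f(z)`, where `a·b = aᵀ A b`. -/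
def HasType (τ : ℂ) (f : Fun m r) (Q : Form m r) : Prop :=
  IsMero f ∧ ∃ A : Matrix (Var m r) (Var m r) ℤ, A.IsSymm ∧ Q = quadForm A ∧
    ∀ k l : Var m r → ℤ,
      GenericEq (fun z => f (fun v => z v + k v + l v * τ))
        (fun z => (-1 : ℂ) ^ (k ⬝ᵥ A.mulVec k) *
          (-Complex.exp (-(Real.pi * Complex.I * τ))) ^ (l ⬝ᵥ A.mulVec l) *
          Complex.exp (-(2 * Real.pi * Complex.I *
            ∑ a, ∑ b, (l a : ℂ) * (A a b : ℂ) * z b)) * f z)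

/-! ## The symmetric group -/

/-- The letters of words: `i : Fin (m - 1)` stands for the simple transposition of the positions
`lft i` and `rgt i = lft i + 1`. -/
def lft (i : Fin (m - 1)) : Fin m := ⟨i.1, by omega⟩

/-- The second of the two positions exchanged by a simple transposition. -/
def rgt (i : Fin (m - 1)) : Fin m := ⟨i.1 + 1, by omega⟩

/-- The simple transposition `s_i`. -/
def simpleRefl (i : Fin (m - 1)) : Equiv.Perm (Fin m) := Equiv.swap (lft i) (rgt i)

/-- The permutation `s_{i_1} ⋯ s_{i_ℓ}` presented by a word. -/
def wordProd (L : List (Fin (m - 1))) : Equiv.Perm (Fin m) := (L.map simpleRefl).prod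

/-- The action on the variables: `x_i ↦ x_{w(i)}`, and `u, h, μ_j` are fixed. -/
def permVar (w : Equiv.Perm (Fin m)) : Equiv.Perm (Var m r) := Equiv.sumCongr w (Equiv.refl _)

/-- The action on polynomials: `x_i ↦ x_{w(i)}`. -/
def permForm (w : Equiv.Perm (Fin m)) (Q : Form m r) : Form m r :=
  MvPolynomial.rename (permVar w) Q

/-- `s_i` acting on functions by exchanging the variables `x_i` and `x_{i+1}`. -/
def reflFun (i : Fin (m - 1)) (f : Fun m r) : Fun m r :=
  fun z => f (fun v => z (permVar (simpleRefl i) v))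

/-- The form `Q - s_i Q` is divisible by `x_i - x_{i+1}`. -/
theorem sub_dvd (i : Fin (m - 1)) (Q : Form m r) :
    (X_ (lft i) - X_ (rgt i) : Form m r) ∣ Q - permForm (simpleRefl i) Q := by
  unfold permForm
  induction Q using MvPolynomial.induction_on with
  | C a => simp
  | add p q hp hq =>
    rw [map_add, add_sub_add_comm]
    exact dvd_add hp hq
  | mul_X p v hp =>
    have hv : (X_ (lft i) - X_ (rgt i) : Form m r) ∣
        MvPolynomial.X v - MvPolynomial.X (permVar (simpleRefl i) v) := by
      rcases v with j | p
      · by_cases h1 : j = lft i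
        · subst h1
          simp [permVar, simpleRefl]
        · by_cases h2 : j = rgt i
          · subst h2
            simp only [permVar, simpleRefl, Equiv.sumCongr_apply, Sum.map_inl,
              Equiv.swap_apply_right]
            rw [← neg_dvd, neg_sub]
          · simp only [permVar, simpleRefl, Equiv.sumCongr_apply, Sum.map_inl,
              Equiv.swap_apply_of_ne_of_ne h1 h2, sub_self, dvd_zero]
      · simp [permVar]
    have e : p * MvPolynomial.X v - MvPolynomial.rename (permVar (simpleRefl i))
          (p * MvPolynomial.X v)
        = (p - MvPolynomial.rename (permVar (simpleRefl i)) p) * MvPolynomial.X v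
          + MvPolynomial.rename (permVar (simpleRefl i)) p *
            (MvPolynomial.X v - MvPolynomial.X (permVar (simpleRefl i) v)) := by
      rw [map_mul, MvPolynomial.rename_X]
      ring
    rw [e]
    exact dvd_add (hp.mul_right _) (hv.mul_left _)

/-- The divided difference `∂_i Q = (Q - s_i Q) / (x_i - x_{i+1})`. -/
def divDiff (i : Fin (m - 1)) (Q : Form m r) : Form m r := (sub_dvd i Q).choose

/-- The defining property of the divided difference. -/
theorem divDiff_spec (i : Fin (m - 1)) (Q : Form m r) :
    Q - permForm (simpleRefl i) Q = (X_ (lft i) - X_ (rgt i)) * divDiff i Q :=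
  (sub_dvd i Q).choose_spec

/-- `ρ_m = -∑ i x_i`, the sum over `i = 1, …, m`. -/
def rho : Form m r := -∑ i : Fin m, ((i.1 : Form m r) + 1) * X_ i

/-- `φ_w(∑ α_i x_i) = ∑_{i < j, w(i) > w(j)} (α_i - α_j)`, as a function of the coefficients. -/
def phi {M : Type*} [AddCommGroup M] (w : Equiv.Perm (Fin m)) (α : Fin m → M) : M :=
  ∑ p ∈ (Finset.univ : Finset (Fin m × Fin m)).filter (fun p => p.1 < p.2 ∧ w p.2 < w p.1),
    (α p.1 - α p.2)

/-! ## The operations -/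

/-- `C_i^ν f = δ(x_{i+1}/x_i, ν) f + δ(x_i/x_{i+1}, h) s_i f`. -/
def C_op (τ : ℂ) (i : Fin (m - 1)) (ν : Form m r) (f : Fun m r) : Fun m r := fun z =>
  delta τ (z (Sum.inl (rgt i)) - z (Sum.inl (lft i))) (ev ν z) * f z +
    delta τ (z (Sum.inl (lft i)) - z (Sum.inl (rgt i))) (z (Sum.inr Par.h)) * reflFun i f z

open scoped Classical in
/-- The normalized operation `δ(ν, h)⁻¹ C_i^ν`. At `ν = 0`, where `C_i^ν` and `δ(ν, h)` have
poles, it is extended by continuity: the two coefficients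
`θ(x_{i+1} - x_i + ν) θ(h) / (θ(x_{i+1} - x_i) θ(ν + h))` and
`θ(x_i - x_{i+1} + h) θ(ν) / (θ(x_i - x_{i+1}) θ(ν + h))` become `1` and `0`. -/
def Cbar (τ : ℂ) (i : Fin (m - 1)) (ν : Form m r) (f : Fun m r) : Fun m r :=
  if ν = 0 then f else fun z => 1 / delta τ (ev ν z) (z (Sum.inr Par.h)) * C_op τ i ν f z

/-- The parameter `∂_i Q - h` forced by purity when the `i`-th operation is applied to a section
of type `Q`. -/
def nu (i : Fin (m - 1)) (Q : Form m r) : Form m r := divDiff i Q - h_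

/-- The type of the first summand `δ(ν, h)⁻¹ δ(x_{i+1}/x_i, ν) f` of the normalized operation
applied to a section `f` of type `Q`, where `ν = nu i Q`. -/
def typeStep (i : Fin (m - 1)) (Q : Form m r) : Form m r :=
  Q + (X_ (rgt i) - X_ (lft i)) * nu i Q - nu i Q * h_

/-- The type obtained from `Q` after performing the operations of a word, the last letter first. -/
def diamondType : List (Fin (m - 1)) → Form m r → Form m r
  | [], Q => Q
  | i :: L, Q => typeStep i (diamondType L Q)

/-- The composition of the normalized operations of a word, the last letter first, applied to a
section `f` of type `Q`; at each step the parameter is the one forced by purity. -/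
def diamond (τ : ℂ) : List (Fin (m - 1)) → Form m r → Fun m r → Fun m r
  | [], _, f => f
  | i :: L, Q, f => Cbar τ i (nu i (diamondType L Q)) (diamond τ L Q f)

/-- The parameter `ν` at each step satisfies `ν + h ≠ 0`. -/
def Nonsingular : List (Fin (m - 1)) → Form m r → Prop
  | [], _ => True
  | i :: L, Q => Nonsingular L Q ∧ nu i (diamondType L Q) + h_ ≠ 0

/-- The parameter `ν` at each step is a form in `u, h, μ_1, …, μ_r` only. -/
def ParamsFreeOfX : List (Fin (m - 1)) → Form m r → Prop
  | [], _ => True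
  | i :: L, Q => ParamsFreeOfX L Q ∧ ∃ p, nu i (diamondType L Q) = ofPar p

end EllipticDemazure

end

/-!
# Elliptic Demazure operations do not depend on the word

With `x = x_i - x_{i+1}`, cancelling `θ(ν)` turns the normalized operation with parameter `ν` into
`f ↦ coeffId x ν · f + coeffRefl x ν · s_i f` (`normOp`), whose coefficients are quotients of theta
functions of integral linear forms; as `θ'(0) ≠ 0`, the two agree on a dense open set
(`Cbar_genericEq_normOp`).

*Purity.* If `∂_i Q` does not involve the `x_j`, differentiating `Q - s_i Q = (x_i - x_{i+1}) ∂_i Q`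
with respect to `x_i` shows that it is an integral linear form. Since `θ(ν)` is pure of type
`ν² / 2` for an integral linear form `ν`, both summands of the operation are pure, and their types
coincide exactly because `ν = ∂_i Q - h` (`hasType_Cbar`). The type of a nonzero function is unique
because its multipliers are determined on an open set (`hasType_unique`).

*Relations.* All identities between the coefficients follow from Weierstrass' three-term identity
(`theta_three_term`). It is the vanishing of the Pfaffian of the antisymmetric 4 × 4 matrix with
entries `K(v_i, v_j)`, where `K(x, y) = θ(x + y) θ(x - y)`: as a function of `x`, `K(x, y)` lies in
a space on which two Fourier coefficients separate points, so the matrix has rank at most two. Hence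
the operations satisfy unitarity, commutation and the braid relation (`Cbar_unitarity`,
`Cbar_comm`, `Cbar_braid`). The parameters forced by purity are those of these relations: applying
`s_i` twice gives `ν, -ν`, and the two sides of a braid relation have the parameters
`ν, ν + ν', ν'` and `ν', ν + ν', ν`.

*Words.* Two words presenting the same permutation are connected by these relations. The
intermediate words must be defined too, which rules out inserting a pair `s_i s_i`. Any word can be
brought into a normal form by commutations, braid moves and cancellations alone
(`exists_common_reduction`), and these moves preserve the hypotheses on the parameters
(`Reduces.diamond_genericEq`).

*The type.* Since `w(a) - a` is the number of inversions of `w` in which `a` comes first minus the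
number of those in which it comes second, `φ_w(∑ α_a x_a) = ∑ (w(a) - a) α_a` (`phi_eq_sum`), and
the formula for the type follows by induction on the word (`typeStep_resultType`).
-/

noncomputable section

namespace EllipticDemazure

open scoped BigOperators Topology

/-! ### The infinite product and the theta function -/

/-- The infinite product `∏_{n ≥ 1} (1 - q^n t)`. -/
def qProd (q t : ℂ) : ℂ := ∏' n : ℕ, (1 - q ^ (n + 1) * t)

lemma summable_norm_pow_mul {q : ℂ} (hq : ‖q‖ < 1) (t : ℂ) :
    Summable fun n : ℕ => ‖-(q ^ (n + 1) * t)‖ := by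
  simpa using ((summable_nat_add_iff 1).mpr
    (summable_geometric_of_lt_one (norm_nonneg _) hq)).mul_right ‖t‖

lemma multipliable_one_sub_pow_mul {q : ℂ} (hq : ‖q‖ < 1) (t : ℂ) :
    Multipliable fun n : ℕ => 1 - q ^ (n + 1) * t := by
  simpa [sub_eq_add_neg] using multipliable_one_add_of_summable (summable_norm_pow_mul hq t)

lemma qProd_one_ne_zero {q : ℂ} (hq : ‖q‖ < 1) : qProd q 1 ≠ 0 := by
  have h := tprod_one_add_ne_zero_of_summable (f := fun n : ℕ => -(q ^ (n + 1) * 1)) ?_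
    (summable_norm_pow_mul hq 1)
  · simpa [qProd, sub_eq_add_neg] using h
  · intro n h
    have h1 : q ^ (n + 1) = 1 := by linear_combination -h
    have h2 : ‖q‖ ^ (n + 1) < 1 := pow_lt_one₀ (norm_nonneg _) hq (by omega)
    rw [← norm_pow, h1] at h2
    simp at h2

lemma qProd_eq_one_sub_mul {q : ℂ} (hq : ‖q‖ < 1) (t : ℂ) :
    qProd q t = (1 - q * t) * qProd q (q * t) := by
  unfold qProd
  rw [tprod_eq_zero_mul']
  · simp only [zero_add, pow_one]
    congr 2
    ext n
    ring
  · convert multipliable_one_sub_pow_mul hq (q * t) using 2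
    ring

lemma differentiable_qProd {q : ℂ} (hq : ‖q‖ < 1) : Differentiable ℂ (qProd q) := by
  have h : MultipliableLocallyUniformlyOn (fun (n : ℕ) t => 1 - q ^ (n + 1) * t)
      (Set.univ : Set ℂ) := by
    use qProd q
    unfold qProd
    simp_rw [sub_eq_add_neg]
    apply hasProdLocallyUniformlyOn_of_forall_compact isOpen_univ
    intro K _ hcK
    obtain ⟨R, hR⟩ := hcK.isBounded.exists_norm_le
    refine (((summable_nat_add_iff 1).mpr
      (summable_geometric_of_lt_one (norm_nonneg _) hq)).mul_right R).hasProdUniformlyOn_nat_one_add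
      hcK (.of_forall fun n x hx => ?_) (fun _ => by fun_prop)
    simp only [norm_neg, norm_mul, norm_pow]
    exact mul_le_mul_of_nonneg_left (hR x hx) (by positivity)
  have := h.hasProdLocallyUniformlyOn.differentiableOn
    (.of_forall fun _ => by simpa [Finset.prod_fn] using
      DifferentiableOn.finsetProd (fun _ _ => by fun_prop)) isOpen_univ
  exact differentiableOn_univ.mp this

section Theta

variable {τ : ℂ}

lemma norm_q_lt_one (hτ : 0 < τ.im) : ‖Complex.exp (2 * Real.pi * Complex.I * τ)‖ < 1 := by
  rw [Complex.norm_exp, Real.exp_lt_one_iff]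
  have : (2 * Real.pi * Complex.I * τ).re = -(2 * Real.pi * τ.im) := by simp
  rw [this]
  have := Real.pi_pos
  have := mul_pos this hτ
  linarith

lemma theta_eq_mul_qProd (hτ : 0 < τ.im) (x : ℂ) :
    theta τ x = 2 * Complex.exp (2 * Real.pi * Complex.I * τ / 8) * Complex.sin (Real.pi * x) *
      (qProd (Complex.exp (2 * Real.pi * Complex.I * τ)) 1 *
        qProd (Complex.exp (2 * Real.pi * Complex.I * τ)) (Complex.exp (2 * Real.pi * Complex.I * x))
        * qProd (Complex.exp (2 * Real.pi * Complex.I * τ))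
          (Complex.exp (-(2 * Real.pi * Complex.I * x)))) := by
  have hq := norm_q_lt_one hτ
  unfold theta qProd
  rw [← (multipliable_one_sub_pow_mul hq _).tprod_mul (multipliable_one_sub_pow_mul hq _),
    ← ((multipliable_one_sub_pow_mul hq _).mul (multipliable_one_sub_pow_mul hq _)).tprod_mul
      (multipliable_one_sub_pow_mul hq _)]
  simp only [mul_one, Complex.exp_neg, div_eq_mul_inv]

lemma differentiable_theta (hτ : 0 < τ.im) : Differentiable ℂ (theta τ) := by
  have hq := differentiable_qProd (norm_q_lt_one hτ)
  rw [funext (theta_eq_mul_qProd hτ)]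
  fun_prop

lemma theta_neg (hτ : 0 < τ.im) (x : ℂ) : theta τ (-x) = -theta τ x := by
  rw [theta_eq_mul_qProd hτ, theta_eq_mul_qProd hτ]
  simp only [mul_neg, Complex.sin_neg, neg_neg]
  ring

lemma theta_zero (hτ : 0 < τ.im) : theta τ 0 = 0 := by
  simp [theta_eq_mul_qProd hτ]

lemma theta_add_one (hτ : 0 < τ.im) (x : ℂ) : theta τ (x + 1) = -theta τ x := by
  have h1 : Complex.exp (2 * Real.pi * Complex.I * (x + 1))
      = Complex.exp (2 * Real.pi * Complex.I * x) := by
    rw [mul_add, Complex.exp_add, mul_one, Complex.exp_two_pi_mul_I, mul_one]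
  rw [theta_eq_mul_qProd hτ, theta_eq_mul_qProd hτ, Complex.exp_neg, Complex.exp_neg, h1, mul_add,
    mul_one, Complex.sin_add_pi]
  ring

lemma theta_add_tau (hτ : 0 < τ.im) (x : ℂ) :
    theta τ (x + τ) = -Complex.exp (-(Real.pi * Complex.I * τ)) *
      Complex.exp (-(2 * Real.pi * Complex.I * x)) * theta τ x := by
  have hq := norm_q_lt_one hτ
  rw [theta_eq_mul_qProd hτ, theta_eq_mul_qProd hτ]
  have e1 : Complex.exp (2 * Real.pi * Complex.I * (x + τ))
      = Complex.exp (2 * Real.pi * Complex.I * τ) * Complex.exp (2 * Real.pi * Complex.I * x) := by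
    rw [← Complex.exp_add]
    ring_nf
  set q := Complex.exp (2 * Real.pi * Complex.I * τ) with hq_def
  have e2 : q * Complex.exp (-(2 * Real.pi * Complex.I * (x + τ)))
      = Complex.exp (-(2 * Real.pi * Complex.I * x)) := by
    rw [hq_def, ← Complex.exp_add]
    ring_nf
  rw [qProd_eq_one_sub_mul hq (Complex.exp (-(2 * Real.pi * Complex.I * (x + τ)))), e2, e1,
    qProd_eq_one_sub_mul hq (Complex.exp (2 * Real.pi * Complex.I * x))]
  -- the identity of elementary factors: `sin(π(x+τ)) (1 - e⁻¹) = -q^(-1/2) e⁻¹ sin(πx) (1 - qe)`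
  have key : Complex.sin (Real.pi * (x + τ)) *
        (1 - Complex.exp (-(2 * Real.pi * Complex.I * x)))
      = -Complex.exp (-(Real.pi * Complex.I * τ)) * Complex.exp (-(2 * Real.pi * Complex.I * x)) *
        Complex.sin (Real.pi * x) * (1 - q * Complex.exp (2 * Real.pi * Complex.I * x)) := by
    set a := Complex.exp (Real.pi * Complex.I * x) with ha
    set b := Complex.exp (Real.pi * Complex.I * τ) with hb
    have ha0 : a ≠ 0 := Complex.exp_ne_zero _
    have hb0 : b ≠ 0 := Complex.exp_ne_zero _
    have f1 : Complex.exp (2 * Real.pi * Complex.I * x) = a ^ 2 := by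
      rw [ha, ← Complex.exp_nat_mul]; ring_nf
    have f2 : q = b ^ 2 := by
      rw [hb, hq_def, ← Complex.exp_nat_mul]; ring_nf
    have f3 : Complex.exp (Real.pi * (x + τ) * Complex.I) = a * b := by
      rw [ha, hb, ← Complex.exp_add]; ring_nf
    have f4 : Complex.exp (Real.pi * x * Complex.I) = a := by
      rw [ha]; ring_nf
    simp only [Complex.sin, neg_mul, Complex.exp_neg, f3, f4, f1, ← hb]
    rw [f2]
    field_simp
    ring
  linear_combination (2 * Complex.exp (2 * Real.pi * Complex.I * τ / 8) * qProd q 1 *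
    qProd q (q * Complex.exp (2 * Real.pi * Complex.I * x)) *
    qProd q (Complex.exp (-(2 * Real.pi * Complex.I * x)))) * key

/-- Up to a nonzero constant, `θ'(0)` is `∏ (1 - q^n)³`. -/
lemma deriv_theta_zero_ne_zero (hτ : 0 < τ.im) : deriv (theta τ) 0 ≠ 0 := by
  have hq := norm_q_lt_one hτ
  have hP := differentiable_qProd hq
  set q := Complex.exp (2 * Real.pi * Complex.I * τ) with hq_def
  set G : ℂ → ℂ := fun x => 2 * Complex.exp (2 * Real.pi * Complex.I * τ / 8) *
    (qProd q 1 * qProd q (Complex.exp (2 * Real.pi * Complex.I * x))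
      * qProd q (Complex.exp (-(2 * Real.pi * Complex.I * x)))) with hG
  have hGd : Differentiable ℂ G := by fun_prop
  have hth : theta τ = fun x => Complex.sin (Real.pi * x) * G x := by
    ext x
    rw [theta_eq_mul_qProd hτ, hG]
    ring
  have hs : HasDerivAt (fun x : ℂ => Complex.sin (Real.pi * x)) Real.pi 0 := by
    have := (Complex.hasDerivAt_sin ((Real.pi : ℂ) * 0)).comp (0 : ℂ)
      ((hasDerivAt_id (0 : ℂ)).const_mul (Real.pi : ℂ))
    simpa [Function.comp_def] using this
  have h : HasDerivAt (theta τ) (Real.pi * G 0) 0 := by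
    rw [hth]
    exact (hs.mul (hGd 0).hasDerivAt).congr_deriv (by simp)
  rw [h.deriv]
  have h1 := qProd_one_ne_zero hq
  have hpi : (Real.pi : ℂ) ≠ 0 := by exact_mod_cast Real.pi_ne_zero
  simp [hG, h1, hpi]

end Theta

/-! ### The three-term identity for theta functions -/

/-- The integral of a periodic entire function over a horizontal period does not depend on the
height. -/
lemma integral_add_eq_of_periodic {G : ℂ → ℂ} (hG : Differentiable ℂ G) (hp : ∀ x, G (x + 1) = G x)
    (c : ℂ) : ∫ t in (0 : ℝ)..1, G (t + c) = ∫ t in (0 : ℝ)..1, G t := by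
  have h1 : ∀ y : ℝ, ∫ t in (0 : ℝ)..1, G (t + y * Complex.I) = ∫ t in (0 : ℝ)..1, G t := by
    intro y
    have h := Complex.integral_boundary_rect_eq_zero_of_differentiableOn G 0 (1 + y * Complex.I)
      hG.differentiableOn
    simp at h
    have hr : ∀ t : ℝ, G (1 + t * Complex.I) = G (t * Complex.I) := fun t => by
      rw [add_comm, hp]
    simp only [hr] at h
    linear_combination -h
  have h2 : Function.Periodic (fun t : ℝ => G (t + c.im * Complex.I)) 1 := by
    intro t
    have := hp (t + c.im * Complex.I)
    simp only [Complex.ofReal_add, Complex.ofReal_one]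
    rw [← this]
    ring_nf
  rw [← h1 c.im]
  have h3 := h2.intervalIntegral_add_eq c.re 0
  rw [zero_add] at h3
  rw [← h3]
  have h4 := intervalIntegral.integral_comp_add_right (a := 0) (b := 1)
    (fun t : ℝ => G (t + c.im * Complex.I)) c.re
  rw [zero_add, add_comm (1 : ℝ)] at h4
  rw [← h4]
  congr 1
  ext t
  congr 1
  conv_lhs => rw [← Complex.re_add_im c]
  push_cast
  ring

/-- A 1-periodic entire function whose Fourier coefficients on the real line all vanish is zero. -/
lemma eq_zero_of_fourier_eq_zero {g : ℂ → ℂ} (hg : Differentiable ℂ g) (hp : ∀ x, g (x + 1) = g x)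
    (h0 : ∀ n : ℤ, ∫ t in (0 : ℝ)..1, Complex.exp (-(2 * Real.pi * Complex.I * n * t)) * g t = 0) :
    g = 0 := by
  have hper : Function.Periodic (fun t : ℝ => g t) 1 := fun t => by
    simpa using hp t
  have hcont : Continuous fun t : ℝ => g t := hg.continuous.comp Complex.continuous_ofReal
  let F : C(AddCircle (1 : ℝ), ℂ) := ⟨hper.lift, continuous_coinduced_dom.mpr hcont⟩
  have hF : ∀ t : ℝ, F (t : AddCircle (1 : ℝ)) = g t := fun t => rfl
  have hco : ∀ n, fourierCoeff F n = 0 := by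
    intro n
    rw [fourierCoeff_eq_intervalIntegral _ n 0]
    simp only [hF, zero_add, one_div, inv_one, one_smul, smul_eq_mul]
    rw [← h0 n]
    congr 1
    ext t
    rw [fourier_coe_apply]
    congr 2
    push_cast
    ring
  have hsum := hasSum_fourier_series_of_summable (f := F)
    (by rw [funext hco]; exact summable_zero)
  have hF0 : F = 0 := by
    refine hsum.unique ?_
    convert hasSum_zero with n
    rw [hco n]
    exact zero_smul ℂ (fourier n : C(AddCircle (1 : ℝ), ℂ))
  have hreal : ∀ t : ℝ, g t = 0 := fun t => by rw [← hF t, hF0, ContinuousMap.zero_apply]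
  have han : AnalyticOnNhd ℂ g Set.univ := hg.differentiableOn.analyticOnNhd isOpen_univ
  have hzero : AnalyticOnNhd ℂ (0 : ℂ → ℂ) Set.univ := analyticOnNhd_const
  refine han.eq_of_frequently_eq (z₀ := 0) hzero ?_
  have ht : Filter.Tendsto (fun n : ℕ => (((1 : ℝ) / (n + 1) : ℝ) : ℂ)) Filter.atTop
      (𝓝[≠] (0 : ℂ)) := by
    refine tendsto_nhdsWithin_iff.mpr ⟨?_, .of_forall fun n => ?_⟩
    · have := (Complex.continuous_ofReal.tendsto 0).comp
        (tendsto_one_div_add_atTop_nhds_zero_nat (𝕜 := ℝ))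
      simpa [Function.comp_def] using this
    · simp only [Set.mem_compl_iff, Set.mem_singleton_iff, Complex.ofReal_eq_zero]
      positivity
  exact ht.frequently (Filter.Frequently.of_forall fun n => hreal _)

/-- The entire functions with `g (x + 1) = g x` and `g (x + τ) = c e^(-4πix) g x` are determined by
two Fourier coefficients: the coefficients satisfy the recursion `a n = c q^(-n) a (n + 2)`. -/
lemma eq_zero_of_quasiperiodic {τ c : ℂ} (hc : c ≠ 0) {g : ℂ → ℂ} (hg : Differentiable ℂ g)
    (hp : ∀ x, g (x + 1) = g x)
    (hτ : ∀ x, g (x + τ) = c * Complex.exp (-(4 * Real.pi * Complex.I * x)) * g x)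
    (h0 : ∫ t in (0 : ℝ)..1, g t = 0)
    (h1 : ∫ t in (0 : ℝ)..1, Complex.exp (-(2 * Real.pi * Complex.I * t)) * g t = 0) :
    g = 0 := by
  set a : ℤ → ℂ := fun n => ∫ t in (0 : ℝ)..1,
    Complex.exp (-(2 * Real.pi * Complex.I * n * t)) * g t with ha
  have hrec : ∀ n, a n = c * Complex.exp (-(2 * Real.pi * Complex.I * n * τ)) * a (n + 2) := by
    intro n
    have hd : Differentiable ℂ fun x => Complex.exp (-(2 * Real.pi * Complex.I * n * x)) * g x := by
      fun_prop
    have h := integral_add_eq_of_periodic hd (fun x => by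
      rw [hp]
      congr 1
      rw [Complex.exp_eq_exp_iff_exists_int]
      exact ⟨-n, by push_cast; ring⟩) τ
    rw [ha]
    simp only
    rw [← h, ← intervalIntegral.integral_const_mul]
    congr 1
    ext t
    rw [hτ]
    have e : Complex.exp (-(2 * Real.pi * Complex.I * n * (t + τ))) *
        Complex.exp (-(4 * Real.pi * Complex.I * t)) =
        Complex.exp (-(2 * Real.pi * Complex.I * n * τ)) *
        Complex.exp (-(2 * Real.pi * Complex.I * (n + 2 : ℤ) * t)) := by
      rw [← Complex.exp_add, ← Complex.exp_add]
      congr 1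
      push_cast
      ring
    linear_combination c * g t * e
  have hiff : ∀ n, a n = 0 ↔ a (n + 2) = 0 := fun n => by
    rw [hrec n]
    simp [hc]
  have a0 : a 0 = 0 := by simpa [ha] using h0
  have a1 : a 1 = 0 := by simpa [ha] using h1
  have hall : ∀ n : ℤ, a n = 0 ∧ a (n + 1) = 0 := by
    intro n
    induction n using Int.induction_on with
    | zero => exact ⟨a0, by simpa using a1⟩
    | succ k ih => exact ⟨ih.2, by rw [add_assoc]; exact (hiff _).mp ih.1⟩
    | pred k ih =>
      refine ⟨(hiff _).mpr ?_, by simpa using ih.1⟩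
      convert ih.2 using 2
      ring
  exact eq_zero_of_fourier_eq_zero hg hp fun n => (hall n).1

/-- Weierstrass' three-term identity. The kernel `K(x, y) = θ(x + y) θ(x - y)` is antisymmetric and
its sections `K(·, y)` lie in a space on which two Fourier coefficients separate points; hence the
antisymmetric matrix `K(v i, v j)` of size four is singular, and the left-hand side is its
Pfaffian. -/
lemma theta_three_term {τ : ℂ} (hτ : 0 < τ.im) (x y z w : ℂ) :
    theta τ (x + y) * theta τ (x - y) * (theta τ (z + w) * theta τ (z - w)) -
      theta τ (x + z) * theta τ (x - z) * (theta τ (y + w) * theta τ (y - w)) +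
      theta τ (x + w) * theta τ (x - w) * (theta τ (y + z) * theta τ (y - z)) = 0 := by
  set K : ℂ → ℂ → ℂ := fun x y => theta τ (x + y) * theta τ (x - y) with hK
  have hθ := differentiable_theta hτ
  have hanti : ∀ a b, K b a = -K a b := fun a b => by
    simp only [hK]
    rw [← neg_sub a b, theta_neg hτ, add_comm]
    ring
  have hdiag : ∀ a, K a a = 0 := fun a => by simp [hK, theta_zero hτ]
  let v : Fin 4 → ℂ := ![x, y, z, w]
  have hKd : ∀ b, Differentiable ℂ fun s => K s b := fun b => by fun_prop
  have hKi : ∀ b, Continuous fun t : ℝ => K t b := fun b =>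
    (hKd b).continuous.comp Complex.continuous_ofReal
  -- the two Fourier coefficients of the four sections are linearly dependent
  let M : Matrix (Fin 2) (Fin 4) ℂ := ![fun j => ∫ t in (0 : ℝ)..1, K t (v j),
    fun j => ∫ t in (0 : ℝ)..1, Complex.exp (-(2 * Real.pi * Complex.I * t)) * K t (v j)]
  obtain ⟨d, hd, hd0⟩ := (Submodule.ne_bot_iff _).mp
    (LinearMap.ker_ne_bot_of_finrank_lt (f := M.mulVecLin) (by simp))
  rw [LinearMap.mem_ker, Matrix.mulVecLin_apply] at hd
  have hg : (fun s => ∑ j, K s (v j) * d j) = 0 := by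
    refine eq_zero_of_quasiperiodic (τ := τ)
      (c := Complex.exp (-(Real.pi * Complex.I * τ)) ^ 2) (by simp) (by fun_prop) ?_ ?_ ?_ ?_
    · intro s
      refine Finset.sum_congr rfl fun j _ => ?_
      simp only [hK]
      rw [add_right_comm, add_sub_right_comm, theta_add_one hτ, theta_add_one hτ]
      ring
    · intro s
      rw [Finset.mul_sum]
      refine Finset.sum_congr rfl fun j _ => ?_
      simp only [hK]
      rw [add_right_comm, add_sub_right_comm, theta_add_tau hτ, theta_add_tau hτ]
      have e : Complex.exp (-(2 * Real.pi * Complex.I * (s + v j))) *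
          Complex.exp (-(2 * Real.pi * Complex.I * (s - v j))) =
          Complex.exp (-(4 * Real.pi * Complex.I * s)) := by
        rw [← Complex.exp_add]
        ring_nf
      rw [← e]
      ring
    · have := congrFun hd 0
      simp only [Matrix.mulVec, dotProduct, M] at this
      rw [intervalIntegral.integral_finsetSum (f := fun j (t : ℝ) => K t (v j) * d j)
        fun j _ => ((hKi _).mul continuous_const).intervalIntegrable _ _]
      simpa [intervalIntegral.integral_mul_const] using this
    · have := congrFun hd 1
      simp only [Matrix.mulVec, dotProduct, M] at this
      simp only [Finset.mul_sum, ← mul_assoc]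
      rw [intervalIntegral.integral_finsetSum (f := fun j (t : ℝ) =>
        Complex.exp (-(2 * Real.pi * Complex.I * t)) * K t (v j) * d j)
        fun j _ => (((by fun_prop : Continuous fun t : ℝ =>
          Complex.exp (-(2 * Real.pi * Complex.I * t))).mul
            (hKi _)).mul continuous_const).intervalIntegrable _ _]
      simpa [intervalIntegral.integral_mul_const] using this
  have hdet : (Matrix.of fun i j => K (v i) (v j)).det = 0 := by
    rw [← Matrix.exists_mulVec_eq_zero_iff]
    exact ⟨d, hd0, funext fun i => congrFun hg (v i)⟩
  have hsq : (K x y * K z w - K x z * K y w + K x w * K y z) ^ 2 = 0 := by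
    rw [← hdet, Matrix.det_succ_row_zero]
    simp [Fin.sum_univ_succ, Matrix.det_fin_three, Fin.succAbove, v]
    rw [hanti x y, hanti x z, hanti x w, hanti y z, hanti y w, hanti z w, hdiag, hdiag, hdiag,
      hdiag]
    ring
  exact pow_eq_zero_iff (two_ne_zero) |>.mp hsq

variable {m r : ℕ}

/-! ### The coefficients of the normalized operation -/

/-- The coefficient of `f` in the normalized operation, as a function of `x = x_i - x_{i+1}`,
of the parameter `ν` and of `h`. -/
def coeffId (τ h x ν : ℂ) : ℂ :=
  theta τ (x - ν) * theta τ h / (theta τ x * theta τ (ν + h))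

/-- The coefficient of `s_i f` in the normalized operation, as a function of `x = x_i - x_{i+1}`,
of the parameter `ν` and of `h`. -/
def coeffRefl (τ h x ν : ℂ) : ℂ :=
  theta τ (x + h) * theta τ ν / (theta τ x * theta τ (ν + h))

section Coefficients

variable {τ : ℂ} {h x y a c ν : ℂ}

lemma coeffId_neg (hτ : 0 < τ.im) : coeffId τ h (-x) ν = theta τ (x + ν) * theta τ h /
    (theta τ x * theta τ (ν + h)) := by
  rw [coeffId, theta_neg hτ, show -x - ν = -(x + ν) by ring, theta_neg hτ, neg_mul, neg_mul,
    neg_div_neg_eq]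

lemma coeffRefl_neg (hτ : 0 < τ.im) : coeffRefl τ h (-x) ν = theta τ (x - h) * theta τ ν /
    (theta τ x * theta τ (ν + h)) := by
  rw [coeffRefl, theta_neg hτ, show -x + h = -(x - h) by ring, theta_neg hτ, neg_mul, neg_mul,
    neg_div_neg_eq]

lemma coeffRefl_mul_comm (μ : ℂ) : coeffRefl τ h x ν * coeffRefl τ h y μ =
    coeffRefl τ h y ν * coeffRefl τ h x μ := by
  simp only [coeffRefl]
  ring

/-- The coefficient of the identity in the composition of the operations with parameters `ν`, `-ν`. -/
lemma coeff_unitarity_id (hτ : 0 < τ.im) (hx : theta τ x ≠ 0) (h1 : theta τ (ν + h) ≠ 0)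
    (h2 : theta τ (-ν + h) ≠ 0) :
    coeffId τ h x (-ν) * coeffId τ h x ν + coeffRefl τ h x (-ν) * coeffRefl τ h (-x) ν = 1 := by
  rw [coeffRefl_neg hτ, coeffRefl, coeffId, coeffId, theta_neg hτ, sub_neg_eq_add]
  have key := theta_three_term hτ x ν h 0
  simp only [add_zero, sub_zero] at key
  rw [show ν - h = -(-ν + h) by ring, theta_neg hτ] at key
  field_simp
  linear_combination key

/-- The coefficient of `s_i` in the composition of the operations with parameters `ν`, `-ν`. -/
lemma coeff_unitarity_refl (hτ : 0 < τ.im) :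
    coeffId τ h x (-ν) * coeffRefl τ h x ν + coeffRefl τ h x (-ν) * coeffId τ h (-x) ν = 0 := by
  rw [coeffId_neg hτ, coeffRefl, coeffRefl, coeffId, theta_neg hτ, sub_neg_eq_add]
  ring

/-- The coefficients of a simple reflection on the two sides of the braid relation. -/
lemma coeff_braid_refl (hτ : 0 < τ.im) (hx : theta τ x ≠ 0) (hy : theta τ y ≠ 0)
    (hxy : theta τ (x + y) ≠ 0) :
    coeffId τ h x c * coeffId τ h y (a + c) * coeffRefl τ h x a +
        coeffRefl τ h x c * coeffId τ h (x + y) (a + c) * coeffId τ h (-x) a =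
      coeffId τ h y a * coeffRefl τ h x (a + c) * coeffId τ h (x + y) c := by
  rw [coeffId_neg hτ]
  simp only [coeffId, coeffRefl]
  have key := theta_three_term hτ ((x + y - c - (a + c)) / 2) ((x - y + a) / 2)
    ((x + y + a) / 2) ((x + y - a) / 2)
  rw [show (x + y - c - (a + c)) / 2 + (x - y + a) / 2 = x - c by ring,
    show (x + y - c - (a + c)) / 2 - (x - y + a) / 2 = y - (a + c) by ring,
    show (x + y + a) / 2 + (x + y - a) / 2 = x + y by ring,
    show (x + y + a) / 2 - (x + y - a) / 2 = a by ring,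
    show (x + y - c - (a + c)) / 2 + (x + y + a) / 2 = x + y - c by ring,
    show (x + y - c - (a + c)) / 2 - (x + y + a) / 2 = -(a + c) by ring,
    show (x - y + a) / 2 + (x + y - a) / 2 = x by ring,
    show (x - y + a) / 2 - (x + y - a) / 2 = -(y - a) by ring,
    show (x + y - c - (a + c)) / 2 + (x + y - a) / 2 = x + y - (a + c) by ring,
    show (x + y - c - (a + c)) / 2 - (x + y - a) / 2 = -c by ring,
    show (x - y + a) / 2 + (x + y + a) / 2 = x + a by ring,
    show (x - y + a) / 2 - (x + y + a) / 2 = -y by ring,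
    theta_neg hτ y, theta_neg hτ c, theta_neg hτ (a + c), theta_neg hτ (y - a)] at key
  generalize theta τ (c + h) = d1
  generalize theta τ (a + c + h) = d2
  generalize theta τ (a + h) = d3
  by_cases e1 : d1 = 0
  · simp [e1]
  by_cases e2 : d2 = 0
  · simp [e2]
  by_cases e3 : d3 = 0
  · simp [e3]
  field_simp
  linear_combination theta τ h ^ 2 * theta τ (x + h) * key

/-- The coefficients of the identity on the two sides of the braid relation. -/
lemma coeff_braid_id (hτ : 0 < τ.im) (hx : theta τ x ≠ 0) (hy : theta τ y ≠ 0)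
    (hxy : theta τ (x + y) ≠ 0) :
    coeffId τ h x c * coeffId τ h y (a + c) * coeffId τ h x a +
        coeffRefl τ h x c * coeffId τ h (x + y) (a + c) * coeffRefl τ h (-x) a =
      coeffId τ h y a * coeffId τ h x (a + c) * coeffId τ h y c +
        coeffRefl τ h y a * coeffId τ h (x + y) (a + c) * coeffRefl τ h (-y) c := by
  rw [coeffRefl_neg hτ, coeffRefl_neg hτ]
  simp only [coeffId, coeffRefl]
  have key1 := theta_three_term hτ y h x 0
  have key2 := theta_three_term hτ (x - (a + c) / 2) ((a - c) / 2) (y - (a + c) / 2) ((a + c) / 2)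
  simp only [add_zero, sub_zero] at key1
  rw [show h - x = -(x - h) by ring, theta_neg hτ (x - h), add_comm h x, add_comm y x] at key1
  rw [show x - (a + c) / 2 + (a - c) / 2 = x - c by ring,
    show x - (a + c) / 2 - (a - c) / 2 = x - a by ring,
    show y - (a + c) / 2 + (a + c) / 2 = y by ring,
    show y - (a + c) / 2 - (a + c) / 2 = y - (a + c) by ring,
    show x - (a + c) / 2 + (y - (a + c) / 2) = x + y - (a + c) by ring,
    show x - (a + c) / 2 - (y - (a + c) / 2) = -(y - x) by ring,
    show (a - c) / 2 + (a + c) / 2 = a by ring, show (a - c) / 2 - (a + c) / 2 = -c by ring,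
    show x - (a + c) / 2 + (a + c) / 2 = x by ring,
    show x - (a + c) / 2 - (a + c) / 2 = x - (a + c) by ring,
    show (a - c) / 2 + (y - (a + c) / 2) = y - c by ring,
    show (a - c) / 2 - (y - (a + c) / 2) = -(y - a) by ring, theta_neg hτ (y - x),
    theta_neg hτ c, theta_neg hτ (y - a)] at key2
  generalize theta τ (c + h) = d1
  generalize theta τ (a + c + h) = d2
  generalize theta τ (a + h) = d3
  by_cases e1 : d1 = 0
  · simp [e1]
  by_cases e2 : d2 = 0
  · simp [e2]
  by_cases e3 : d3 = 0
  · simp [e3]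
  field_simp
  linear_combination theta τ h ^ 3 * theta τ (x + y) * key2 -
    theta τ h * theta τ a * theta τ c * theta τ (x + y - (a + c)) * key1

end Coefficients

/-! ### Generic equality -/

/-- The filter of sets containing a dense open set. -/
def generic (m r : ℕ) : Filter (Pt m r) where
  sets := {S | ∃ U : Set (Pt m r), IsOpen U ∧ Dense U ∧ U ⊆ S}
  univ_sets := ⟨Set.univ, isOpen_univ, dense_univ, subset_rfl⟩
  sets_of_superset := fun ⟨U, h1, h2, h3⟩ h => ⟨U, h1, h2, h3.trans h⟩
  inter_sets := fun ⟨U, h1, h2, h3⟩ ⟨V, k1, k2, k3⟩ =>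
    ⟨U ∩ V, h1.inter k1, h2.inter_of_isOpen_left k2 h1, Set.inter_subset_inter h3 k3⟩

lemma genericEq_iff {f g : Fun m r} : GenericEq f g ↔ f =ᶠ[generic m r] g := Iff.rfl

lemma GenericEq.refl (f : Fun m r) : GenericEq f f :=
  Filter.EventuallyEq.refl (generic m r) f

lemma GenericEq.symm {f g : Fun m r} (h : GenericEq f g) : GenericEq g f :=
  Filter.EventuallyEq.symm (genericEq_iff.mp h)

lemma GenericEq.trans {f g k : Fun m r} (h : GenericEq f g) (h' : GenericEq g k) :
    GenericEq f k :=
  Filter.EventuallyEq.trans (genericEq_iff.mp h) (genericEq_iff.mp h')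

lemma tendsto_generic (e : Pt m r ≃ₜ Pt m r) : Filter.Tendsto e (generic m r) (generic m r) := by
  rintro S ⟨U, h1, h2, h3⟩
  exact ⟨e ⁻¹' U, h1.preimage e.continuous, h2.preimage e.isOpenMap, fun x hx => h3 hx⟩

lemma GenericEq.comp_homeomorph {f g : Fun m r} (h : GenericEq f g) (e : Pt m r ≃ₜ Pt m r) :
    GenericEq (fun z => f (e z)) (fun z => g (e z)) :=
  (tendsto_generic e).eventually h

/-- The permutation of coordinates, as a homeomorphism. -/
def permPt (σ : Equiv.Perm (Var m r)) : Pt m r ≃ₜ Pt m r :=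
  { toEquiv := Equiv.arrowCongr σ.symm (Equiv.refl ℂ)
    continuous_toFun := continuous_pi fun v => continuous_apply (σ v)
    continuous_invFun := continuous_pi fun v => continuous_apply (σ.symm v) }

lemma permPt_apply (σ : Equiv.Perm (Var m r)) (z : Pt m r) : permPt σ z = fun v => z (σ v) := by
  rfl

lemma GenericEq.reflFun {f g : Fun m r} (h : GenericEq f g) (i : Fin (m - 1)) :
    GenericEq (reflFun i f) (reflFun i g) :=
  h.comp_homeomorph (permPt (permVar (simpleRefl i)))

lemma Cbar_congr {τ : ℂ} {f g : Fun m r} (h : GenericEq f g) (i : Fin (m - 1)) (ν : Form m r) :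
    GenericEq (Cbar τ i ν f) (Cbar τ i ν g) := by
  unfold Cbar
  split_ifs
  · exact h
  · have h' := h.reflFun i
    rw [genericEq_iff] at h h' ⊢
    filter_upwards [h, h'] with z h1 h2
    simp only [C_op, h1, h2]

/-! ### Meromorphic functions -/

/-- The germs of analytic functions at a point form a domain. -/
lemma not_eventually_mul_eq_zero {p q : Fun m r} {z : Pt m r} (hp : AnalyticAt ℂ p z)
    (hq : AnalyticAt ℂ q z) (hp0 : ¬ ∀ᶠ y in 𝓝 z, p y = 0) (hq0 : ¬ ∀ᶠ y in 𝓝 z, q y = 0) :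
    ¬ ∀ᶠ y in 𝓝 z, p y * q y = 0 := by
  intro h
  obtain ⟨ε, hε, hB⟩ := Metric.eventually_nhds_iff_ball.mp
    (h.and (hp.eventually_analyticAt.and hq.eventually_analyticAt))
  have hball : Metric.ball z ε ∈ 𝓝 z := Metric.ball_mem_nhds z hε
  obtain ⟨y, hpy, hy⟩ := ((Filter.not_eventually.mp hp0).and_eventually hball).exists
  have hqy : q =ᶠ[𝓝 y] 0 := by
    filter_upwards [(hB y hy).2.1.continuousAt.eventually_ne hpy,
      Metric.isOpen_ball.mem_nhds hy] with w hw hwB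
    exact (mul_eq_zero.mp (hB w hwB).1).resolve_left hw
  have han : AnalyticOnNhd ℂ q (Metric.ball z ε) := fun w hw => (hB w hw).2.2
  have := han.eqOn_zero_of_preconnected_of_eventuallyEq_zero
    (convex_ball z ε).isPreconnected hy hqy
  exact hq0 (Filter.mem_of_superset hball this)

lemma IsMero.mul {f g : Fun m r} (hf : IsMero f) (hg : IsMero g) :
    IsMero (fun z => f z * g z) := by
  intro z
  obtain ⟨p, q, hp, hq, hq0, h⟩ := hf z
  obtain ⟨p', q', hp', hq', hq0', h'⟩ := hg z
  refine ⟨_, _, hp.mul hp', hq.mul hq', not_eventually_mul_eq_zero hq hq' hq0 hq0', ?_⟩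
  filter_upwards [h, h'] with y hy hy' hne
  rw [Pi.mul_apply] at hne
  rw [hy (left_ne_zero_of_mul hne), hy' (right_ne_zero_of_mul hne), Pi.mul_apply, Pi.mul_apply,
    div_mul_div_comm]

lemma IsMero.add {f g : Fun m r} (hf : IsMero f) (hg : IsMero g) :
    IsMero (fun z => f z + g z) := by
  intro z
  obtain ⟨p, q, hp, hq, hq0, h⟩ := hf z
  obtain ⟨p', q', hp', hq', hq0', h'⟩ := hg z
  refine ⟨_, _, (hp.mul hq').add (hq.mul hp'), hq.mul hq',
    not_eventually_mul_eq_zero hq hq' hq0 hq0', ?_⟩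
  filter_upwards [h, h'] with y hy hy' hne
  rw [Pi.mul_apply] at hne
  rw [hy (left_ne_zero_of_mul hne), hy' (right_ne_zero_of_mul hne),
    div_add_div _ _ (left_ne_zero_of_mul hne) (right_ne_zero_of_mul hne)]
  rfl

lemma isMero_of_analytic {f : Fun m r} (hf : ∀ z, AnalyticAt ℂ f z) : IsMero f := fun z =>
  ⟨f, fun _ => 1, hf z, analyticAt_const, by simp [(inferInstance : (𝓝 z).NeBot).ne],
    .of_forall fun y _ => by simp⟩

/-- The inverse of a holomorphic function is meromorphic; where the function vanishes identically,
so does the inverse, by the convention `0⁻¹ = 0`. -/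
lemma isMero_inv_of_analytic {f : Fun m r} (hf : ∀ z, AnalyticAt ℂ f z) :
    IsMero (fun z => (f z)⁻¹) := by
  intro z
  by_cases h : ∀ᶠ y in 𝓝 z, f y = 0
  · refine ⟨fun _ => 0, fun _ => 1, analyticAt_const, analyticAt_const,
      by simp [(inferInstance : (𝓝 z).NeBot).ne], ?_⟩
    filter_upwards [h] with y hy _
    simp [hy]
  · exact ⟨fun _ => 1, f, analyticAt_const, hf z, h, .of_forall fun y _ => by simp⟩

lemma analyticAt_permPt (σ : Equiv.Perm (Var m r)) (z : Pt m r) :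
    AnalyticAt ℂ (permPt σ : Pt m r → Pt m r) z := by
  rw [show (permPt σ : Pt m r → Pt m r) = fun z v => z (σ v) from funext (permPt_apply σ)]
  exact analyticAt_pi_iff.mpr fun v =>
    (ContinuousLinearMap.proj (R := ℂ) (φ := fun _ : Var m r => ℂ) (σ v)).analyticAt z

lemma IsMero.reflFun {f : Fun m r} (hf : IsMero f) (i : Fin (m - 1)) : IsMero (reflFun i f) := by
  intro z
  set e := permPt (m := m) (r := r) (permVar (simpleRefl i)) with he
  obtain ⟨p, q, hp, hq, hq0, h⟩ := hf (e z)
  refine ⟨fun y => p (e y), fun y => q (e y), hp.comp (analyticAt_permPt _ z),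
    hq.comp (analyticAt_permPt _ z), ?_, ?_⟩
  · intro h'
    rw [← e.map_nhds_eq] at hq0
    exact hq0 h'
  · have := e.continuous.continuousAt.eventually h
    filter_upwards [this] with y hy
    rw [he, permPt_apply] at hy ⊢
    exact hy

/-! ### Theta functions of integral linear forms -/

/-- The value at `z` of the integral linear form with coefficients `n`. -/
def lin (n : Var m r → ℤ) (z : Pt m r) : ℂ := ∑ v, (n v : ℂ) * z v

lemma lin_add (n k : Var m r → ℤ) (z : Pt m r) : lin (n + k) z = lin n z + lin k z := by
  simp [lin, add_mul, Finset.sum_add_distrib]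

lemma lin_neg (n : Var m r → ℤ) (z : Pt m r) : lin (-n) z = -lin n z := by
  simp [lin]

lemma lin_sub (n k : Var m r → ℤ) (z : Pt m r) : lin (n - k) z = lin n z - lin k z := by
  rw [sub_eq_add_neg, lin_add, lin_neg, sub_eq_add_neg]

lemma lin_single (v : Var m r) (z : Pt m r) : lin (Pi.single v 1) z = z v := by
  simp only [lin, Pi.single_apply]
  rw [Finset.sum_eq_single v] <;> simp +contextual

/-- The theta function of an integral linear form. -/
def thetaLin (τ : ℂ) (n : Var m r → ℤ) : Fun m r := fun z => theta τ (lin n z)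

lemma continuous_lin (n : Var m r → ℤ) : Continuous (lin n : Pt m r → ℂ) := by
  unfold lin
  fun_prop

lemma analyticAt_thetaLin {τ : ℂ} (hτ : 0 < τ.im) (n : Var m r → ℤ) (z : Pt m r) :
    AnalyticAt ℂ (thetaLin τ n) z := by
  have h1 : AnalyticAt ℂ (lin n : Pt m r → ℂ) z := by
    unfold lin
    exact Finset.analyticAt_fun_sum _ fun v _ => analyticAt_const.mul
      ((ContinuousLinearMap.proj (R := ℂ) (φ := fun _ : Var m r => ℂ) v).analyticAt z)
  exact ((differentiable_theta hτ).analyticAt _).comp h1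

/-- Since `θ'(0) ≠ 0`, the theta function of a nonzero linear form does not vanish on any open
set. -/
lemma eventually_thetaLin_ne_zero {τ : ℂ} (hτ : 0 < τ.im) {n : Var m r → ℤ} (hn : n ≠ 0) :
    ∀ᶠ z in generic m r, thetaLin τ n z ≠ 0 := by
  have hθ := differentiable_theta hτ
  refine ⟨{z | thetaLin τ n z ≠ 0}, ?_, ?_, subset_rfl⟩
  · exact isOpen_ne_fun (hθ.continuous.comp (continuous_lin n)) continuous_const
  · intro z
    by_contra hz
    rw [mem_closure_iff_frequently, Filter.not_frequently] at hz
    simp only [Set.mem_ofPred_eq, not_not] at hz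
    obtain ⟨v, hv⟩ := Function.ne_iff.mp hn
    have hv' : (n v : ℂ) ≠ 0 := by exact_mod_cast hv
    -- restrict to a line on which the linear form is a coordinate centred at its value at `z`
    have hc : Filter.Tendsto (fun t : ℂ => z + ((t - lin n z) / n v) • (Pi.single v 1 : Pt m r))
        (𝓝 (lin n z)) (𝓝 z) := by
      have : Continuous fun t : ℂ => z + ((t - lin n z) / n v) • (Pi.single v 1 : Pt m r) := by
        fun_prop
      simpa using this.tendsto (lin n z)
    have h0 : theta τ =ᶠ[𝓝 (lin n z)] 0 := by
      filter_upwards [hc.eventually hz] with t ht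
      have e : lin n (z + ((t - lin n z) / n v) • (Pi.single v 1 : Pt m r)) = t := by
        have : lin n (z + ((t - lin n z) / n v) • (Pi.single v 1 : Pt m r))
            = lin n z + (t - lin n z) / n v * n v := by
          simp only [lin, Pi.add_apply, Pi.smul_apply, smul_eq_mul, mul_add,
            Finset.sum_add_distrib, Pi.single_apply]
          congr 1
          rw [Finset.sum_eq_single v]
          · simp [mul_comm]
          · intro b _ hb
            simp [hb]
          · simp
        rw [this]
        field_simp
        ring
      rwa [thetaLin, e] at ht
    have han : AnalyticOnNhd ℂ (theta τ) Set.univ := hθ.differentiableOn.analyticOnNhd isOpen_univ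
    have hall := han.eqOn_zero_of_preconnected_of_eventuallyEq_zero isPreconnected_univ
      (Set.mem_univ _) h0
    have : theta τ = fun _ => 0 := funext fun x => hall (Set.mem_univ x)
    apply deriv_theta_zero_ne_zero hτ
    rw [this]
    simp

/-! ### Words and braid moves -/

/-- One word reduces to another if it can be transformed into it by commutations, braid moves and
cancellations `s_i s_i → 1`; unlike in the word problem for a group presented by generators and
relations, cancellations may not be reversed. -/
inductive Reduces : List (Fin (m - 1)) → List (Fin (m - 1)) → Prop
  | refl (L) : Reduces L L
  | trans {L M N} : Reduces L M → Reduces M N → Reduces L N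
  | cons (i) {L M} : Reduces L M → Reduces (i :: L) (i :: M)
  | cancel (i L) : Reduces (i :: i :: L) L
  | comm (i j : Fin (m - 1)) (L) : (i.1 + 1 < j.1 ∨ j.1 + 1 < i.1) →
      Reduces (i :: j :: L) (j :: i :: L)
  | braid (i j : Fin (m - 1)) (L) : (i.1 + 1 = j.1 ∨ j.1 + 1 = i.1) →
      Reduces (i :: j :: i :: L) (j :: i :: j :: L)

lemma Reduces.append_left (S : List (Fin (m - 1))) {L M : List (Fin (m - 1))} (h : Reduces L M) :
    Reduces (S ++ L) (S ++ M) := by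
  induction S with
  | nil => exact h
  | cons i S ih => exact ih.cons i

lemma simpleRefl_mul_self (i : Fin (m - 1)) : simpleRefl i * simpleRefl i = 1 :=
  Equiv.swap_mul_self _ _

lemma simpleRefl_comm {i j : Fin (m - 1)} (h : i.1 + 1 < j.1 ∨ j.1 + 1 < i.1) :
    simpleRefl i * simpleRefl j = simpleRefl j * simpleRefl i := by
  apply Equiv.Perm.Disjoint.commute
  intro x
  by_cases hx : x = lft i ∨ x = rgt i
  · right
    apply Equiv.swap_apply_of_ne_of_ne <;>
    · rintro rfl
      simp only [lft, rgt, Fin.mk.injEq] at hx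
      omega
  · left
    push Not at hx
    exact Equiv.swap_apply_of_ne_of_ne hx.1 hx.2

lemma simpleRefl_braid {i j : Fin (m - 1)} (h : i.1 + 1 = j.1) :
    simpleRefl i * simpleRefl j * simpleRefl i = simpleRefl j * simpleRefl i * simpleRefl j := by
  have e : lft j = rgt i := Fin.ext h.symm
  have h1 : lft i ≠ rgt i := by simp [lft, rgt, Fin.ext_iff]
  have h2 : rgt j ≠ rgt i := by simp [rgt, Fin.ext_iff]; omega
  have h3 : lft i ≠ rgt j := by simp [lft, rgt, Fin.ext_iff]; omega
  simp only [simpleRefl, e]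
  calc Equiv.swap (lft i) (rgt i) * Equiv.swap (rgt i) (rgt j) * Equiv.swap (lft i) (rgt i)
      = Equiv.swap (lft i) (rgt j) := by
        rw [Equiv.swap_comm (lft i) (rgt i), Equiv.swap_comm (rgt i) (rgt j),
          Equiv.swap_mul_swap_mul_swap h2 h3.symm]
    _ = _ := by rw [Equiv.swap_mul_swap_mul_swap h1 h3, Equiv.swap_comm]

@[simp] lemma wordProd_nil : wordProd ([] : List (Fin (m - 1))) = 1 := rfl

@[simp] lemma wordProd_cons (i : Fin (m - 1)) (L : List (Fin (m - 1))) :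
    wordProd (i :: L) = simpleRefl i * wordProd L := by
  simp [wordProd]

@[simp] lemma wordProd_append (L M : List (Fin (m - 1))) :
    wordProd (L ++ M) = wordProd L * wordProd M := by
  simp [wordProd]

lemma Reduces.wordProd_eq {L M : List (Fin (m - 1))} (h : Reduces L M) :
    wordProd L = wordProd M := by
  induction h with
  | refl => rfl
  | trans _ _ h1 h2 => exact h1.trans h2
  | cons i _ h => simp [h]
  | cancel i L => simp [← mul_assoc, simpleRefl_mul_self]
  | comm i j L h => simp [← mul_assoc, simpleRefl_comm h]
  | braid i j L h =>
    simp only [wordProd_cons, ← mul_assoc]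
    rcases h with h | h
    · rw [simpleRefl_braid h]
    · rw [simpleRefl_braid h]

/-- `Seg a k S` says that `S` is the word with the consecutive letters `a, a + 1, …, k - 1`. -/
inductive Seg : ℕ → ℕ → List (Fin (m - 1)) → Prop
  | nil (k) : Seg k k []
  | cons (i : Fin (m - 1)) {k S} : Seg (i.1 + 1) k S → Seg i.1 k (i :: S)

/-- Normal words for the permutations of the first `k` positions: a segment ending in the letter
`k - 2`, which moves the position `k - 1` to its image, followed by a normal word for the
permutations of the first `k - 1` positions. -/
inductive NormalWord : ℕ → List (Fin (m - 1)) → Prop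
  | nil : NormalWord 0 []
  | succ {a k S L} : Seg a k S → NormalWord k L → NormalWord (k + 1) (S ++ L)

lemma Seg.le {a k : ℕ} {S : List (Fin (m - 1))} (h : Seg a k S) : a ≤ k := by
  induction h with
  | nil => rfl
  | cons i _ ih => omega

lemma Seg.unique {a k : ℕ} {S T : List (Fin (m - 1))} (h : Seg a k S) (h' : Seg a k T) :
    S = T := by
  induction h generalizing T with
  | nil k =>
    generalize hb : k = b at h'
    cases h' with
    | nil => rfl
    | cons i hi =>
      have := hi.le
      omega
  | cons i hi ih =>
    have := hi.le
    generalize hb : i.1 = b at h'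
    cases h' with
    | nil => omega
    | cons j hj =>
      obtain rfl := Fin.ext hb
      rw [ih hj]

/-- A letter commutes with a segment of larger letters not adjacent to it. -/
lemma Seg.reduces_of_lt {a k : ℕ} {S : List (Fin (m - 1))} (h : Seg a k S) {i : Fin (m - 1)}
    (hi : i.1 + 1 < a) (L : List (Fin (m - 1))) : Reduces (i :: (S ++ L)) (S ++ i :: L) := by
  induction h with
  | nil => exact .refl _
  | cons j _ ih => exact (Reduces.comm i j _ (.inl hi)).trans ((ih (by omega)).cons j)

/-- A letter of a segment other than the first moves through the segment and becomes the preceding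
letter. -/
lemma Seg.reduces_of_gt {a k : ℕ} {S : List (Fin (m - 1))} (h : Seg a k S) {i : Fin (m - 1)}
    (hai : a < i.1) (hik : i.1 < k) (L : List (Fin (m - 1))) :
    ∃ j : Fin (m - 1), j.1 + 1 = i.1 ∧ Reduces (i :: (S ++ L)) (S ++ j :: L) := by
  induction h with
  | nil => omega
  | @cons a k S hS ih =>
    rcases Nat.lt_or_eq_of_le (Nat.succ_le_of_lt hai) with h | h
    · obtain ⟨j, hj, hr⟩ := ih h hik
      exact ⟨j, hj, (Reduces.comm i a _ (.inr h)).trans (hr.cons a)⟩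
    · refine ⟨a, h, ?_⟩
      have h' : a.1 + 1 = i.1 := h
      rw [h'] at hS
      generalize hb : i.1 = b at hS
      cases hS with
      | nil => omega
      | @cons c _ T hT =>
        obtain rfl := Fin.ext hb
        exact (Reduces.braid i a _ (.inr h')).trans
          (((hT.reduces_of_lt (i := a) (by omega) L).cons i).cons a)

/-- Multiplying a normal word by a letter on the left: depending on its position relative to the first
segment, the letter passes through the segment, extends it or cancels its first letter. -/
lemma NormalWord.exists_reduces_cons {k : ℕ} {L : List (Fin (m - 1))} (h : NormalWord k L)
    (i : Fin (m - 1)) (hi : i.1 + 1 < k) : ∃ M, NormalWord k M ∧ Reduces (i :: L) M := by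
  induction h generalizing i with
  | nil => omega
  | @succ a k S L hS hL ih =>
    rcases lt_trichotomy a i.1 with h | h | h
    · obtain ⟨j, hj, hr⟩ := hS.reduces_of_gt h (by omega) L
      obtain ⟨M, hM, hM'⟩ := ih j (by omega)
      exact ⟨S ++ M, .succ hS hM, hr.trans (hM'.append_left S)⟩
    · generalize hb : a = b at hS
      cases hS with
      | nil => omega
      | @cons j _ T hT =>
        obtain rfl := Fin.ext (h.symm.trans hb)
        exact ⟨T ++ L, .succ hT hL, .cancel _ _⟩
    · rcases Nat.lt_or_eq_of_le (Nat.succ_le_of_lt h) with h' | h'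
      · have := hS.le
        obtain ⟨M, hM, hM'⟩ := ih i (by omega)
        exact ⟨S ++ M, .succ hS hM, (hS.reduces_of_lt h' L).trans (hM'.append_left S)⟩
      · have h'' : i.1 + 1 = a := h'
        subst h''
        exact ⟨i :: S ++ L, .succ (.cons i hS) hL, .refl _⟩

lemma normalWord_nil (k : ℕ) : NormalWord k ([] : List (Fin (m - 1))) := by
  induction k with
  | zero => exact .nil
  | succ k ih => exact .succ (.nil k) ih

lemma exists_normalWord (L : List (Fin (m - 1))) : ∃ M, NormalWord m M ∧ Reduces L M := by
  induction L with
  | nil => exact ⟨[], normalWord_nil m, .refl _⟩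
  | cons i L ih =>
    obtain ⟨M, hM, hr⟩ := ih
    obtain ⟨N, hN, hr'⟩ := hM.exists_reduces_cons i (by omega)
    exact ⟨N, hN, (hr.cons i).trans hr'⟩

lemma Seg.wordProd_apply_of_gt {a k : ℕ} {S : List (Fin (m - 1))} (h : Seg a k S) {p : Fin m}
    (hp : k < p.1) : wordProd S p = p := by
  induction h with
  | nil => rfl
  | cons i hS ih =>
    have := hS.le
    rw [wordProd_cons, Equiv.Perm.mul_apply, ih hp]
    apply Equiv.swap_apply_of_ne_of_ne <;>
    · rintro rfl
      simp only [lft, rgt] at hp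
      omega

lemma Seg.wordProd_apply {a k : ℕ} {S : List (Fin (m - 1))} (h : Seg a k S) {p : Fin m}
    (hp : p.1 = k) : (wordProd S p).1 = a := by
  induction h with
  | nil => exact hp
  | cons i hS ih =>
    have : wordProd _ p = rgt i := Fin.ext (ih hp)
    rw [wordProd_cons, Equiv.Perm.mul_apply, this, simpleRefl, Equiv.swap_apply_right]
    rfl

lemma NormalWord.wordProd_apply {k : ℕ} {L : List (Fin (m - 1))} (h : NormalWord k L) {p : Fin m}
    (hp : k ≤ p.1) : wordProd L p = p := by
  induction h with
  | nil => rfl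
  | succ hS _ ih =>
    rw [wordProd_append, Equiv.Perm.mul_apply, ih (by omega), hS.wordProd_apply_of_gt (by omega)]

/-- A normal word is determined by its permutation: the image of the last
position determines the first segment, since the rest of the word fixes this position. -/
lemma NormalWord.unique {k : ℕ} (hk : k ≤ m) {L M : List (Fin (m - 1))} (h : NormalWord k L)
    (h' : NormalWord k M) (hLM : wordProd L = wordProd M) : L = M := by
  induction h generalizing M with
  | nil => cases h'; rfl
  | @succ a k S L hS hL ih =>
    cases h' with
    | @succ b _ T M hT hM =>
      have hp : (⟨k, hk⟩ : Fin m).1 = k := rfl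
      have h1 : a = b := by
        rw [← hS.wordProd_apply hp, ← hT.wordProd_apply hp]
        have := congrArg (fun w => (w ⟨k, hk⟩).1) hLM
        simpa [hL.wordProd_apply, hM.wordProd_apply] using this
      subst h1
      obtain rfl := hS.unique hT
      rw [wordProd_append, wordProd_append] at hLM
      rw [ih (by omega) hM (mul_left_cancel hLM)]

/-- Two words presenting the same permutation have a common reduction. -/
lemma exists_common_reduction {L M : List (Fin (m - 1))} (h : wordProd L = wordProd M) :
    ∃ N, Reduces L N ∧ Reduces M N := by
  obtain ⟨N, hN, hL⟩ := exists_normalWord L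
  obtain ⟨N', hN', hM⟩ := exists_normalWord M
  have : N = N' := hN.unique le_rfl hN' (by rw [← hL.wordProd_eq, h, hM.wordProd_eq])
  subst this
  exact ⟨N, hL, hM⟩

/-! ### Linear and quadratic forms with integral coefficients -/

/-- The linear form with integral coefficients `n`. -/
def linForm (n : Var m r → ℤ) : Form m r := ∑ v, MvPolynomial.C (n v : ℚ) * MvPolynomial.X v

lemma linForm_add (n k : Var m r → ℤ) : linForm (n + k) = linForm n + linForm k := by
  simp [linForm, add_mul, Finset.sum_add_distrib]

lemma linForm_neg (n : Var m r → ℤ) : linForm (-n) = -linForm n := by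
  simp [linForm]

lemma linForm_sub (n k : Var m r → ℤ) : linForm (n - k) = linForm n - linForm k := by
  rw [sub_eq_add_neg, linForm_add, linForm_neg, sub_eq_add_neg]

lemma linForm_zero : linForm (0 : Var m r → ℤ) = 0 := by simp [linForm]

lemma linForm_single (v : Var m r) : linForm (Pi.single v 1) = MvPolynomial.X v := by
  rw [linForm, Finset.sum_eq_single v] <;> simp +contextual

lemma pderiv_linForm (v : Var m r) (n : Var m r → ℤ) :
    MvPolynomial.pderiv v (linForm n) = MvPolynomial.C (n v : ℚ) := by
  simp only [linForm, map_sum, MvPolynomial.pderiv_C_mul, MvPolynomial.pderiv_X]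
  rw [Finset.sum_eq_single v] <;> simp +contextual

lemma linForm_injective : Function.Injective (linForm : (Var m r → ℤ) → Form m r) := by
  intro n k h
  ext v
  have := congrArg (MvPolynomial.pderiv v) h
  rw [pderiv_linForm, pderiv_linForm] at this
  exact_mod_cast MvPolynomial.C_injective _ _ this

lemma linForm_ne_zero {n : Var m r → ℤ} : linForm n ≠ 0 ↔ n ≠ 0 := by
  rw [← linForm_zero (m := m) (r := r)]
  exact linForm_injective.ne_iff

lemma ev_linForm (n : Var m r → ℤ) (z : Pt m r) : ev (linForm n) z = lin n z := by
  simp [ev, linForm, lin]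

lemma quadForm_add (A B : Matrix (Var m r) (Var m r) ℤ) :
    quadForm (A + B) = quadForm A + quadForm B := by
  simp only [quadForm, ← mul_add, ← Finset.sum_add_distrib, Matrix.add_apply, Int.cast_add,
    map_add, add_mul]

lemma quadForm_neg (A : Matrix (Var m r) (Var m r) ℤ) : quadForm (-A) = -quadForm A := by
  simp only [quadForm, Matrix.neg_apply, Int.cast_neg, map_neg, neg_mul, Finset.sum_neg_distrib,
    mul_neg]

lemma quadForm_vecMulVec (n : Var m r → ℤ) :
    quadForm (Matrix.vecMulVec n n) = MvPolynomial.C (1 / 2) * linForm n ^ 2 := by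
  have h : linForm n ^ 2 = ∑ a, ∑ b, MvPolynomial.C ((Matrix.vecMulVec n n a b : ℤ) : ℚ) *
      MvPolynomial.X a * MvPolynomial.X b := by
    rw [sq, linForm, Finset.sum_mul_sum]
    refine Finset.sum_congr rfl fun a _ => Finset.sum_congr rfl fun b _ => ?_
    rw [Matrix.vecMulVec_apply, Int.cast_mul, MvPolynomial.C_mul]
    ring
  rw [h, quadForm]

lemma pderiv_quadForm {A : Matrix (Var m r) (Var m r) ℤ} (hA : A.IsSymm) (v : Var m r) :
    MvPolynomial.pderiv v (quadForm A) = linForm (fun w => A v w) := by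
  have h1 : ∀ a b : Var m r, MvPolynomial.pderiv v
      (MvPolynomial.C (A a b : ℚ) * MvPolynomial.X a * MvPolynomial.X b) =
      (if a = v then MvPolynomial.C (A a b : ℚ) * MvPolynomial.X b else 0) +
      (if b = v then MvPolynomial.C (A a b : ℚ) * MvPolynomial.X a else 0) := by
    intro a b
    rw [Derivation.leibniz, MvPolynomial.pderiv_C_mul, MvPolynomial.pderiv_X,
      MvPolynomial.pderiv_X]
    simp only [Pi.single_apply, smul_eq_mul]
    split_ifs <;> ring
  rw [quadForm, MvPolynomial.pderiv_C_mul]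
  simp only [map_sum, h1, Finset.sum_add_distrib]
  rw [Finset.sum_comm]
  simp only [Finset.sum_ite_eq', Finset.mem_univ, if_true]
  have h2 : ∀ a, A a v = A v a := fun a => hA.apply v a
  simp only [h2]
  rw [linForm, ← two_mul, ← mul_assoc, show (2 : Form m r) = MvPolynomial.C 2 from rfl,
    ← MvPolynomial.C_mul]
  norm_num

lemma quadForm_injOn {A B : Matrix (Var m r) (Var m r) ℤ} (hA : A.IsSymm) (hB : B.IsSymm)
    (h : quadForm A = quadForm B) : A = B := by
  ext v w
  have := congrArg (MvPolynomial.pderiv v) h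
  rw [pderiv_quadForm hA, pderiv_quadForm hB] at this
  exact congrFun (linForm_injective this) w

lemma permForm_quadForm (i : Fin (m - 1)) (A : Matrix (Var m r) (Var m r) ℤ) :
    permForm (simpleRefl i) (quadForm A) =
      quadForm (A.submatrix (permVar (simpleRefl i)) (permVar (simpleRefl i))) := by
  set σ := permVar (m := m) (r := r) (simpleRefl i) with hσ
  have hσ2 : ∀ v, σ (σ v) = v := by
    rintro (v | v) <;> simp [hσ, permVar, simpleRefl]
  rw [permForm, quadForm, quadForm, ← hσ]
  simp only [map_mul, map_sum, MvPolynomial.rename_C, MvPolynomial.rename_X]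
  congr 1
  refine Fintype.sum_equiv σ _ _ fun a => Fintype.sum_equiv σ _ _ fun b => ?_
  simp [hσ2]

/-! ### Divided differences -/

lemma X_sub_X_ne_zero (i : Fin (m - 1)) : (X_ (lft i) - X_ (rgt i) : Form m r) ≠ 0 := by
  rw [sub_ne_zero]
  intro h
  have := MvPolynomial.X_injective h
  simp [lft, rgt] at this

lemma divDiff_eq_of_mul {i : Fin (m - 1)} {Q D : Form m r}
    (h : Q - permForm (simpleRefl i) Q = (X_ (lft i) - X_ (rgt i)) * D) : divDiff i Q = D :=
  mul_left_cancel₀ (X_sub_X_ne_zero i) ((divDiff_spec i Q).symm.trans h)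

lemma permForm_ofPar (w : Equiv.Perm (Fin m)) (p : MvPolynomial (Par r) ℚ) :
    permForm w (ofPar p : Form m r) = ofPar p := by
  rw [permForm, ofPar, MvPolynomial.rename_rename]
  rfl

lemma permForm_X (w : Equiv.Perm (Fin m)) (a : Fin m) :
    permForm w (X_ a : Form m r) = X_ (w a) := by
  rw [permForm, MvPolynomial.rename_X]
  rfl

lemma permForm_add (w : Equiv.Perm (Fin m)) (P Q : Form m r) :
    permForm w (P + Q) = permForm w P + permForm w Q := map_add _ _ _

lemma permForm_sub (w : Equiv.Perm (Fin m)) (P Q : Form m r) :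
    permForm w (P - Q) = permForm w P - permForm w Q := map_sub _ _ _

lemma permForm_mul (w : Equiv.Perm (Fin m)) (P Q : Form m r) :
    permForm w (P * Q) = permForm w P * permForm w Q := map_mul _ _ _

lemma h_eq_ofPar : (h_ : Form m r) = ofPar (MvPolynomial.X Par.h) := by
  rw [ofPar, MvPolynomial.rename_X]

lemma ofPar_add (p q : MvPolynomial (Par r) ℚ) :
    (ofPar (p + q) : Form m r) = ofPar p + ofPar q := map_add _ _ _

lemma ofPar_sub (p q : MvPolynomial (Par r) ℚ) :
    (ofPar (p - q) : Form m r) = ofPar p - ofPar q := map_sub _ _ _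

lemma pderiv_ofPar (j : Fin m) (p : MvPolynomial (Par r) ℚ) :
    MvPolynomial.pderiv (Sum.inl j) (ofPar p : Form m r) = 0 := by
  apply MvPolynomial.pderiv_eq_zero_of_notMem_vars
  intro h
  have := MvPolynomial.vars_rename _ _ h
  simp at this

/-- For a section with a type, a parameter not involving the `x_i` is an integral linear form. -/
lemma exists_nu_eq_linForm {A : Matrix (Var m r) (Var m r) ℤ} (hA : A.IsSymm) {i : Fin (m - 1)}
    {p : MvPolynomial (Par r) ℚ} (hp : nu i (quadForm A) = ofPar p) :
    ∃ n : Var m r → ℤ, (∀ j, n (Sum.inl j) = 0) ∧ nu i (quadForm A) = linForm n := by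
  set σ := permVar (m := m) (r := r) (simpleRefl i) with hσ
  have hD : divDiff i (quadForm A) = ofPar (p + MvPolynomial.X Par.h) := by
    rw [ofPar_add, ← h_eq_ofPar, ← hp, nu]
    ring
  have hS : (A.submatrix σ σ).IsSymm := hA.submatrix _
  -- differentiating `Q - s_i Q = (x_i - x_{i+1}) ∂_i Q` with respect to `x_i` isolates `∂_i Q`
  have h1 := congrArg (MvPolynomial.pderiv (Sum.inl (lft i))) (divDiff_spec i (quadForm A))
  have hne : (Sum.inl (rgt i) : Var m r) ≠ Sum.inl (lft i) := by simp [lft, rgt]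
  rw [permForm_quadForm, map_sub, pderiv_quadForm hA, pderiv_quadForm hS, ← linForm_sub,
    Derivation.leibniz, hD, pderiv_ofPar, map_sub, MvPolynomial.pderiv_X_self,
    MvPolynomial.pderiv_X_of_ne hne, smul_zero, zero_add, sub_zero, smul_eq_mul, mul_one,
    ← hD] at h1
  have h2 : nu i (quadForm A) = linForm ((fun w => A (Sum.inl (lft i)) w) -
      (fun w => A.submatrix σ σ (Sum.inl (lft i)) w) - Pi.single (Sum.inr Par.h) 1) := by
    rw [nu, ← h1, linForm_sub _ (Pi.single _ _), linForm_single]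
  refine ⟨_, fun j => ?_, h2⟩
  have h3 := congrArg (MvPolynomial.pderiv (Sum.inl j)) (h2.symm.trans hp)
  rw [pderiv_linForm, pderiv_ofPar, MvPolynomial.C_eq_zero] at h3
  exact_mod_cast h3

/-! ### Multipliers -/

/-- The multiplier of the sections of the line bundle given by the matrix `A`. -/
def multiplier (τ : ℂ) (A : Matrix (Var m r) (Var m r) ℤ) (k l : Var m r → ℤ) (z : Pt m r) : ℂ :=
  (-1 : ℂ) ^ (k ⬝ᵥ A.mulVec k) *
    (-Complex.exp (-(Real.pi * Complex.I * τ))) ^ (l ⬝ᵥ A.mulVec l) *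
    Complex.exp (-(2 * Real.pi * Complex.I * ∑ a, ∑ b, (l a : ℂ) * (A a b : ℂ) * z b))

/-- The transformation law in the definition of a type. -/
def HasMult (τ : ℂ) (f : Fun m r) (A : Matrix (Var m r) (Var m r) ℤ) : Prop :=
  ∀ k l : Var m r → ℤ, GenericEq (fun z => f (fun v => z v + k v + l v * τ))
    (fun z => multiplier τ A k l z * f z)

lemma hasType_iff {τ : ℂ} {f : Fun m r} {Q : Form m r} :
    HasType τ f Q ↔ IsMero f ∧ ∃ A : Matrix (Var m r) (Var m r) ℤ, A.IsSymm ∧ Q = quadForm A ∧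
      HasMult τ f A := Iff.rfl

section Mult

variable {τ : ℂ} {A B : Matrix (Var m r) (Var m r) ℤ} {k l : Var m r → ℤ} {z : Pt m r}
  {f g : Fun m r}

lemma multiplier_ne_zero : multiplier τ A k l z ≠ 0 :=
  mul_ne_zero (mul_ne_zero (zpow_ne_zero _ (by simp)) (zpow_ne_zero _ (by simp)))
    (Complex.exp_ne_zero _)

lemma multiplier_add :
    multiplier τ (A + B) k l z = multiplier τ A k l z * multiplier τ B k l z := by
  simp only [multiplier, Matrix.add_mulVec, dotProduct_add]
  rw [zpow_add₀ (by simp), zpow_add₀ (by simp)]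
  have : ∑ a, ∑ b, (l a : ℂ) * ((A + B) a b : ℤ) * z b =
      ∑ a, ∑ b, (l a : ℂ) * A a b * z b + ∑ a, ∑ b, (l a : ℂ) * B a b * z b := by
    simp only [← Finset.sum_add_distrib, Matrix.add_apply, Int.cast_add, mul_add, add_mul]
  rw [this, mul_add, neg_add, Complex.exp_add]
  ring

lemma multiplier_neg : multiplier τ (-A) k l z = (multiplier τ A k l z)⁻¹ := by
  apply eq_inv_of_mul_eq_one_left
  rw [← multiplier_add]
  simp [multiplier]

/-- The translation by a vector of the period lattice, as a homeomorphism. -/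
def shiftPt (τ : ℂ) (k l : Var m r → ℤ) : Pt m r ≃ₜ Pt m r :=
  Homeomorph.addRight fun v => (k v : ℂ) + l v * τ

lemma shiftPt_apply : shiftPt τ k l z = fun v => z v + k v + l v * τ := by
  ext v
  simp [shiftPt, add_assoc]

lemma HasMult.congr (h : HasMult τ f A) (hfg : GenericEq f g) : HasMult τ g A := by
  intro k l
  have h1 := h k l
  have h2 := hfg.comp_homeomorph (shiftPt τ k l)
  simp only [shiftPt_apply] at h2
  rw [genericEq_iff] at *
  filter_upwards [h1, h2, hfg] with z a b c
  rw [← b, a, c]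

lemma HasMult.mul (h : HasMult τ f A) (h' : HasMult τ g B) :
    HasMult τ (fun z => f z * g z) (A + B) := by
  intro k l
  have h1 := h k l
  have h2 := h' k l
  rw [genericEq_iff] at *
  filter_upwards [h1, h2] with z a b
  rw [a, b, multiplier_add]
  ring

lemma HasMult.inv (h : HasMult τ f A) : HasMult τ (fun z => (f z)⁻¹) (-A) := by
  intro k l
  have h1 := h k l
  rw [genericEq_iff] at *
  filter_upwards [h1] with z a
  rw [a, multiplier_neg, mul_inv]

lemma HasMult.add (h : HasMult τ f A) (h' : HasMult τ g A) :
    HasMult τ (fun z => f z + g z) A := by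
  intro k l
  have h1 := h k l
  have h2 := h' k l
  rw [genericEq_iff] at *
  filter_upwards [h1, h2] with z a b
  rw [a, b]
  ring

lemma permVar_simpleRefl_self (i : Fin (m - 1)) (v : Var m r) :
    permVar (simpleRefl i) (permVar (simpleRefl i) v) = v := by
  rcases v with v | v <;> simp [permVar, simpleRefl]

lemma HasMult.reflFun (h : HasMult τ f A) (i : Fin (m - 1)) : HasMult τ (reflFun i f)
    (A.submatrix (permVar (simpleRefl i)) (permVar (simpleRefl i))) := by
  intro k l
  set σ := permVar (m := m) (r := r) (simpleRefl i) with hσ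
  have hσ2 : ∀ v, σ (σ v) = v := permVar_simpleRefl_self i
  have h1 := (h (fun v => k (σ v)) (fun v => l (σ v))).comp_homeomorph (permPt σ)
  simp only [permPt_apply] at h1
  rw [genericEq_iff] at *
  filter_upwards [h1] with z a
  have hdot : ∀ k : Var m r → ℤ, (fun v => k (σ v)) ⬝ᵥ A.mulVec (fun v => k (σ v)) =
      k ⬝ᵥ (A.submatrix σ σ).mulVec k := by
    intro k
    refine Fintype.sum_equiv σ _ _ fun a => ?_
    congr 1
    refine Fintype.sum_equiv σ _ _ fun b => ?_
    simp [hσ2]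
  have hmul : multiplier τ A (fun v => k (σ v)) (fun v => l (σ v)) (fun v => z (σ v)) =
      multiplier τ (A.submatrix σ σ) k l z := by
    rw [multiplier, multiplier, hdot, hdot]
    congr 4
    refine Fintype.sum_equiv σ _ _ fun a => Fintype.sum_equiv σ _ _ fun b => ?_
    simp [hσ2]
  rw [← hmul]
  exact a

end Mult

lemma theta_add_int {τ : ℂ} (hτ : 0 < τ.im) (x : ℂ) (K : ℤ) :
    theta τ (x + K) = (-1) ^ K * theta τ x := by
  induction K using Int.induction_on with
  | zero => simp
  | succ K ih =>
    push_cast at ih ⊢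
    rw [← add_assoc, theta_add_one hτ, ih, zpow_add_one₀ (by simp)]
    ring
  | pred K ih =>
    have h := theta_add_one hτ (x + ((-K - 1 : ℤ) : ℂ))
    rw [show x + ((-K - 1 : ℤ) : ℂ) + 1 = x + ((-K : ℤ) : ℂ) by push_cast; ring, ih] at h
    rw [zpow_sub_one₀ (by simp), inv_neg, inv_one]
    linear_combination h

lemma theta_add_int_mul {τ : ℂ} (hτ : 0 < τ.im) (x : ℂ) (L : ℤ) :
    theta τ (x + L * τ) = (-Complex.exp (-(Real.pi * Complex.I * τ))) ^ (L ^ 2) *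
      Complex.exp (-(2 * Real.pi * Complex.I * (L * x))) * theta τ x := by
  set c := -Complex.exp (-(Real.pi * Complex.I * τ)) with hc
  have hc0 : c ≠ 0 := by simp [hc]
  have hc2 : ∀ L : ℤ, Complex.exp (-(2 * Real.pi * Complex.I * (L * τ))) = c ^ (2 * L) := by
    intro L
    rw [zpow_mul, show c ^ (2 : ℤ) = c ^ 2 from rfl, hc, neg_sq, ← Complex.exp_nat_mul,
      ← Complex.exp_int_mul]
    congr 1
    push_cast
    ring
  -- the passage from `L` to `L + 1`, in a form that can be read in both directions
  have hstep : ∀ L : ℤ, theta τ (x + (L + 1 : ℤ) * τ) = c ^ (2 * L + 1) *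
      Complex.exp (-(2 * Real.pi * Complex.I * x)) * theta τ (x + L * τ) := by
    intro L
    rw [show x + (L + 1 : ℤ) * τ = x + L * τ + τ by push_cast; ring, theta_add_tau hτ, ← hc,
      zpow_add_one₀ hc0, ← hc2, mul_add, neg_add, Complex.exp_add]
    ring
  have hexp : ∀ L : ℤ, Complex.exp (-(2 * Real.pi * Complex.I * ((L + 1 : ℤ) * x))) =
      Complex.exp (-(2 * Real.pi * Complex.I * (L * x))) *
        Complex.exp (-(2 * Real.pi * Complex.I * x)) := by
    intro L
    rw [← Complex.exp_add]
    congr 1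
    push_cast
    ring
  have hpow : ∀ L : ℤ, c ^ ((L + 1) ^ 2) = c ^ (L ^ 2) * c ^ (2 * L + 1) := by
    intro L
    rw [← zpow_add₀ hc0]
    ring_nf
  induction L using Int.induction_on with
  | zero => simp
  | succ K ih =>
    rw [hstep, ih, hpow, hexp]
    ring
  | pred K ih =>
    have h1 := hstep (-K - 1)
    have h2 := hexp (-K - 1)
    have h3 := hpow (-K - 1)
    rw [sub_add_cancel] at h1 h2 h3
    rw [ih, h2, h3] at h1
    have h4 : c ^ (2 * (-(K : ℤ) - 1) + 1) * Complex.exp (-(2 * Real.pi * Complex.I * x)) ≠ 0 :=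
      mul_ne_zero (zpow_ne_zero _ hc0) (Complex.exp_ne_zero _)
    apply mul_left_cancel₀ h4
    linear_combination -h1

lemma neg_one_zpow_sq (K : ℤ) : (-1 : ℂ) ^ (K ^ 2) = (-1) ^ K := by
  rcases Int.even_or_odd K with h | h
  · rw [h.neg_one_zpow, (h.pow_of_ne_zero two_ne_zero).neg_one_zpow]
  · rw [h.neg_one_zpow, h.pow.neg_one_zpow]

/-- The function `θ(ν)` is pure of type `ν² / 2`, the quadratic form of the matrix `n nᵀ`. -/
lemma hasMult_thetaLin {τ : ℂ} (hτ : 0 < τ.im) (n : Var m r → ℤ) :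
    HasMult τ (thetaLin τ n) (Matrix.vecMulVec n n) := by
  intro k l
  rw [genericEq_iff]
  refine .of_forall fun z => ?_
  have hdot : ∀ k : Var m r → ℤ, k ⬝ᵥ (Matrix.vecMulVec n n).mulVec k = (n ⬝ᵥ k) ^ 2 := by
    intro k
    simp only [dotProduct, Matrix.mulVec, Matrix.vecMulVec_apply, sq, Finset.sum_mul_sum]
    refine Finset.sum_congr rfl fun a _ => ?_
    rw [Finset.mul_sum]
    exact Finset.sum_congr rfl fun b _ => by ring
  have hsum : ∑ a, ∑ b, (l a : ℂ) * (Matrix.vecMulVec n n a b : ℤ) * z b =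
      (n ⬝ᵥ l : ℤ) * lin n z := by
    simp only [dotProduct, lin, Matrix.vecMulVec_apply, Int.cast_sum, Int.cast_mul,
      Finset.sum_mul_sum]
    exact Finset.sum_congr rfl fun a _ => Finset.sum_congr rfl fun b _ => by ring
  have hlin : lin n (fun v => z v + k v + l v * τ) =
      lin n z + (n ⬝ᵥ k : ℤ) + (n ⬝ᵥ l : ℤ) * τ := by
    simp only [lin, dotProduct, Int.cast_sum, Int.cast_mul, Finset.sum_mul,
      ← Finset.sum_add_distrib]
    exact Finset.sum_congr rfl fun a _ => by ring
  simp only [thetaLin, multiplier, hdot, hsum, hlin]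
  rw [theta_add_int_mul hτ, theta_add_int hτ, neg_one_zpow_sq, mul_add, mul_add, neg_add,
    Complex.exp_add]
  have h1 : Complex.exp (-(2 * Real.pi * Complex.I *
      ((n ⬝ᵥ l : ℤ) * ((n ⬝ᵥ k : ℤ) : ℂ)))) = 1 := by
    rw [Complex.exp_eq_one_iff]
    exact ⟨-((n ⬝ᵥ l) * (n ⬝ᵥ k)), by push_cast; ring⟩
  rw [h1]
  ring

/-! ### The parameters forced by purity -/

/-- A step with a parameter not involving the `x_i` changes the other parameters by multiples of it;
the factor `c` is the divided difference of `x_{j+1} - x_j`. -/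
lemma nu_typeStep_of {i j : Fin (m - 1)} {Q c : Form m r} {p : MvPolynomial (Par r) ℚ}
    (hp : nu j Q = ofPar p)
    (hc : (X_ (rgt j) - X_ (lft j) : Form m r) -
      (X_ (simpleRefl i (rgt j)) - X_ (simpleRefl i (lft j))) = (X_ (lft i) - X_ (rgt i)) * c) :
    nu i (typeStep j Q) = nu i Q + c * nu j Q := by
  have h : divDiff i (typeStep j Q) = divDiff i Q + c * nu j Q := by
    apply divDiff_eq_of_mul
    have h1 := divDiff_spec i Q
    rw [typeStep, hp, h_eq_ofPar]
    simp only [permForm_add, permForm_sub, permForm_mul, permForm_ofPar, permForm_X]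
    linear_combination h1 + ofPar p * hc
  rw [nu, h, nu, nu]
  ring

lemma lft_ne_rgt (i : Fin (m - 1)) : lft i ≠ rgt i := by simp [lft, rgt]

lemma simpleRefl_lft (i : Fin (m - 1)) : simpleRefl i (lft i) = rgt i := Equiv.swap_apply_left _ _

lemma simpleRefl_rgt (i : Fin (m - 1)) : simpleRefl i (rgt i) = lft i := Equiv.swap_apply_right _ _

lemma nu_typeStep_self {i : Fin (m - 1)} {Q : Form m r} {p : MvPolynomial (Par r) ℚ}
    (hp : nu i Q = ofPar p) : nu i (typeStep i Q) = -nu i Q := by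
  rw [nu_typeStep_of (c := -2) hp (by rw [simpleRefl_lft, simpleRefl_rgt]; ring)]
  ring

lemma nu_typeStep_comm {i j : Fin (m - 1)} (hij : i.1 + 1 < j.1 ∨ j.1 + 1 < i.1) {Q : Form m r}
    {p : MvPolynomial (Par r) ℚ} (hp : nu j Q = ofPar p) : nu i (typeStep j Q) = nu i Q := by
  have h1 : simpleRefl i (rgt j) = rgt j := by
    apply Equiv.swap_apply_of_ne_of_ne <;> simp only [lft, rgt, ne_eq, Fin.mk.injEq] <;> omega
  have h2 : simpleRefl i (lft j) = lft j := by
    apply Equiv.swap_apply_of_ne_of_ne <;> simp only [lft, rgt, ne_eq, Fin.mk.injEq] <;> omega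
  rw [nu_typeStep_of (c := 0) hp (by rw [h1, h2]; ring)]
  ring

lemma nu_typeStep_adjacent {i j : Fin (m - 1)} (hij : i.1 + 1 = j.1 ∨ j.1 + 1 = i.1)
    {Q : Form m r} {p : MvPolynomial (Par r) ℚ} (hp : nu j Q = ofPar p) :
    nu i (typeStep j Q) = nu i Q + nu j Q := by
  rw [nu_typeStep_of (c := 1) hp, one_mul]
  rcases hij with hij | hij
  · have h1 : simpleRefl i (rgt j) = rgt j := by
      apply Equiv.swap_apply_of_ne_of_ne <;> simp only [lft, rgt, ne_eq, Fin.mk.injEq] <;> omega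
    have h2 : lft j = rgt i := Fin.ext hij.symm
    rw [h1, h2, simpleRefl_rgt]
    ring
  · have h1 : simpleRefl i (lft j) = lft j := by
      apply Equiv.swap_apply_of_ne_of_ne <;> simp only [lft, rgt, ne_eq, Fin.mk.injEq] <;> omega
    have h2 : rgt j = lft i := Fin.ext hij
    rw [h1, h2, simpleRefl_lft]
    ring

/-! ### The normalized operation with cleared poles -/

/-- The point with the coordinates `x_i` and `x_{i+1}` exchanged. -/
def act (i : Fin (m - 1)) (z : Pt m r) : Pt m r := fun v => z (permVar (simpleRefl i) v)

lemma act_act (i : Fin (m - 1)) (z : Pt m r) : act i (act i z) = z := by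
  ext v
  simp only [act, permVar_simpleRefl_self]

lemma act_inl (i : Fin (m - 1)) (z : Pt m r) (a : Fin m) :
    act i z (Sum.inl a) = z (Sum.inl (simpleRefl i a)) := rfl

lemma act_inr (i : Fin (m - 1)) (z : Pt m r) (p : Par r) : act i z (Sum.inr p) = z (Sum.inr p) :=
  rfl

lemma act_comm {i j : Fin (m - 1)} (h : i.1 + 1 < j.1 ∨ j.1 + 1 < i.1) (z : Pt m r) :
    act i (act j z) = act j (act i z) := by
  ext (a | p)
  · simp only [act_inl, ← Equiv.Perm.mul_apply, simpleRefl_comm h]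
  · rfl

lemma act_braid {i j : Fin (m - 1)} (h : i.1 + 1 = j.1) (z : Pt m r) :
    act i (act j (act i z)) = act j (act i (act j z)) := by
  ext (a | p)
  · simp only [act_inl, ← Equiv.Perm.mul_apply, ← mul_assoc, simpleRefl_braid h]
  · rfl

lemma lin_act {n : Var m r → ℤ} (hn : ∀ j, n (Sum.inl j) = 0) (i : Fin (m - 1)) (z : Pt m r) :
    lin n (act i z) = lin n z := by
  simp [lin, hn, act_inr]

/-- The normalized operation whose parameter is the integral linear form with coefficients `n`,
with the factor `θ(ν)` cancelled, so that the case `ν = 0` is not special. -/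
def normOp (τ : ℂ) (i : Fin (m - 1)) (n : Var m r → ℤ) (f : Fun m r) : Fun m r := fun z =>
  coeffId τ (z (Sum.inr Par.h)) (z (Sum.inl (lft i)) - z (Sum.inl (rgt i))) (lin n z) * f z +
    coeffRefl τ (z (Sum.inr Par.h)) (z (Sum.inl (lft i)) - z (Sum.inl (rgt i))) (lin n z) *
      f (act i z)

/-- The coefficients of the linear form `h`. -/
def hVec (m r : ℕ) : Var m r → ℤ := Pi.single (Sum.inr Par.h) 1

/-- The coefficients of the linear form `x_a - x_b`. -/
def diffVec (a b : Fin m) : Var m r → ℤ := Pi.single (Sum.inl a) 1 - Pi.single (Sum.inl b) 1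

lemma lin_hVec (z : Pt m r) : lin (hVec m r) z = z (Sum.inr Par.h) := lin_single _ _

lemma lin_diffVec (a b : Fin m) (z : Pt m r) :
    lin (diffVec a b) z = z (Sum.inl a) - z (Sum.inl b) := by
  rw [diffVec, lin_sub, lin_single, lin_single]

lemma linForm_hVec : linForm (hVec m r) = h_ := linForm_single _

lemma linForm_diffVec (a b : Fin m) : linForm (diffVec (r := r) a b) = X_ a - X_ b := by
  rw [diffVec, linForm_sub, linForm_single, linForm_single]

lemma hVec_ne_zero : hVec m r ≠ 0 := by simp [hVec]

lemma diffVec_ne_zero {a b : Fin m} (hab : a ≠ b) : diffVec (r := r) a b ≠ 0 := by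
  intro h
  have := congrFun h (Sum.inl a)
  simp [diffVec, hab] at this

lemma normOp_congr {τ : ℂ} {f g : Fun m r} (h : GenericEq f g) (i : Fin (m - 1))
    (n : Var m r → ℤ) : GenericEq (normOp τ i n f) (normOp τ i n g) := by
  have h' : GenericEq (fun z => f (act i z)) (fun z => g (act i z)) := h.reflFun i
  rw [genericEq_iff] at h h' ⊢
  filter_upwards [h, h'] with z h1 h2
  simp only [normOp, h1, h2]

lemma Cbar_genericEq_normOp {τ : ℂ} (hτ : 0 < τ.im) (i : Fin (m - 1)) (n : Var m r → ℤ)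
    (f : Fun m r) : GenericEq (Cbar τ i (linForm n) f) (normOp τ i n f) := by
  have hx := eventually_thetaLin_ne_zero (r := r) hτ (diffVec_ne_zero (lft_ne_rgt i))
  have hh := eventually_thetaLin_ne_zero hτ (hVec_ne_zero (m := m) (r := r))
  rw [genericEq_iff]
  by_cases hn : n = 0
  · subst hn
    rw [linForm_zero, Cbar, if_pos rfl]
    filter_upwards [hx, hh] with z h1 h2
    rw [thetaLin, lin_diffVec] at h1
    rw [thetaLin, lin_hVec] at h2
    have h0 : lin (0 : Var m r → ℤ) z = 0 := by simp [lin]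
    rw [normOp, h0, coeffId, coeffRefl, theta_zero hτ, sub_zero, zero_add,
      div_self (mul_ne_zero h1 h2)]
    ring
  · rw [Cbar, if_neg (linForm_ne_zero.mpr hn)]
    filter_upwards [hx, hh, eventually_thetaLin_ne_zero hτ hn] with z h1 h2 h3
    rw [thetaLin, lin_diffVec] at h1
    rw [thetaLin, lin_hVec] at h2
    rw [thetaLin] at h3
    have hd := deriv_theta_zero_ne_zero hτ
    have hr : reflFun i f z = f (act i z) := rfl
    rw [C_op, hr, ev_linForm, normOp, coeffId, coeffRefl]
    simp only [delta]
    rw [show z (Sum.inl (rgt i)) - z (Sum.inl (lft i)) =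
        -(z (Sum.inl (lft i)) - z (Sum.inl (rgt i))) by ring]
    generalize z (Sum.inl (lft i)) - z (Sum.inl (rgt i)) = x at *
    rw [theta_neg hτ x, show -x + lin n z = -(x - lin n z) by ring, theta_neg hτ (x - lin n z)]
    generalize theta τ (lin n z + z (Sum.inr Par.h)) = d
    by_cases hd0 : d = 0
    · simp [hd0]
    field_simp

/-- The first coefficient as a quotient of theta functions of integral linear forms. -/
lemma coeffId_lin (τ : ℂ) (x n : Var m r → ℤ) (z : Pt m r) :
    coeffId τ (lin (hVec m r) z) (lin x z) (lin n z) =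
      thetaLin τ (x - n) z * thetaLin τ (hVec m r) z *
        ((thetaLin τ x z)⁻¹ * (thetaLin τ (n + hVec m r) z)⁻¹) := by
  simp only [coeffId, thetaLin, lin_sub, lin_add, div_eq_mul_inv, mul_inv]

/-- The second coefficient as a quotient of theta functions of integral linear forms. -/
lemma coeffRefl_lin (τ : ℂ) (x n : Var m r → ℤ) (z : Pt m r) :
    coeffRefl τ (lin (hVec m r) z) (lin x z) (lin n z) =
      thetaLin τ (x + hVec m r) z * thetaLin τ n z *
        ((thetaLin τ x z)⁻¹ * (thetaLin τ (n + hVec m r) z)⁻¹) := by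
  simp only [coeffRefl, thetaLin, lin_add, div_eq_mul_inv, mul_inv]

lemma delta_lin (τ : ℂ) (a b : Var m r → ℤ) (z : Pt m r) :
    delta τ (lin a z) (lin b z) = deriv (theta τ) 0 * thetaLin τ (a + b) z *
      ((thetaLin τ a z)⁻¹ * (thetaLin τ b z)⁻¹) := by
  simp only [delta, thetaLin, lin_add, div_eq_mul_inv, mul_inv]

lemma one_div_delta_lin (τ : ℂ) (a b : Var m r → ℤ) (z : Pt m r) :
    1 / delta τ (lin a z) (lin b z) = (deriv (theta τ) 0)⁻¹ * (thetaLin τ (a + b) z)⁻¹ *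
      (thetaLin τ a z * thetaLin τ b z) := by
  simp only [delta_lin, one_div, mul_inv, inv_inv]

lemma isMero_Cbar {τ : ℂ} (hτ : 0 < τ.im) {f : Fun m r} (hf : IsMero f) (i : Fin (m - 1))
    (n : Var m r → ℤ) : IsMero (Cbar τ i (linForm n) f) := by
  unfold Cbar
  split_ifs
  · exact hf
  · have ht : ∀ n : Var m r → ℤ, IsMero (thetaLin τ n) := fun n =>
      isMero_of_analytic (analyticAt_thetaLin hτ n)
    have hti : ∀ n : Var m r → ℤ, IsMero fun z => (thetaLin τ n z)⁻¹ := fun n =>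
      isMero_inv_of_analytic (analyticAt_thetaLin hτ n)
    have hc : ∀ c : ℂ, IsMero fun _ : Pt m r => c := fun c =>
      isMero_of_analytic fun _ => analyticAt_const
    have hd : ∀ a b : Var m r → ℤ, IsMero fun z => delta τ (lin a z) (lin b z) := fun a b => by
      simp only [delta_lin]
      exact ((hc _).mul (ht _)).mul ((hti _).mul (hti _))
    simp only [C_op, ev_linForm, ← lin_hVec, ← lin_diffVec, one_div_delta_lin]
    exact (((hc _).mul (hti _)).mul ((ht _).mul (ht _))).mul
      (((hd _ _).mul hf).add ((hd _ _).mul (hf.reflFun i)))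

/-! ### Purity -/

/-- Both summands of the normalized operation, with the parameter forced by purity, have the same
type. -/
lemma hasType_Cbar {τ : ℂ} (hτ : 0 < τ.im) {f : Fun m r} {Q : Form m r} (hf : HasType τ f Q)
    {i : Fin (m - 1)} {p : MvPolynomial (Par r) ℚ} (hp : nu i Q = ofPar p) :
    HasType τ (Cbar τ i (nu i Q) f) (typeStep i Q) := by
  obtain ⟨hm, A, hA, rfl, hmult⟩ := hasType_iff.mp hf
  obtain ⟨n, -, hn⟩ := exists_nu_eq_linForm hA hp
  set x : Var m r → ℤ := diffVec (lft i) (rgt i) with hx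
  set h := hVec m r with hh
  set σ := permVar (m := m) (r := r) (simpleRefl i) with hσ
  have ht := fun n : Var m r → ℤ => hasMult_thetaLin hτ n
  have hV : ∀ v : Var m r → ℤ, (Matrix.vecMulVec v v).IsSymm := fun v => by
    ext a b
    simp [Matrix.vecMulVec_apply, mul_comm]
  have m1 := (((ht (x - n)).mul (ht h)).mul ((ht x).inv.mul (ht (n + h)).inv)).mul hmult
  have m2 := (((ht (x + h)).mul (ht n)).mul ((ht x).inv.mul (ht (n + h)).inv)).mul
    (hmult.reflFun i)
  set A1 := Matrix.vecMulVec (x - n) (x - n) + Matrix.vecMulVec h h +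
    (-Matrix.vecMulVec x x + -Matrix.vecMulVec (n + h) (n + h)) + A with hA1
  set A2 := Matrix.vecMulVec (x + h) (x + h) + Matrix.vecMulVec n n +
    (-Matrix.vecMulVec x x + -Matrix.vecMulVec (n + h) (n + h)) + A.submatrix σ σ with hA2
  have s1 : A1.IsSymm :=
    (((hV _).add (hV _)).add ((hV _).neg.add (hV _).neg)).add hA
  have s2 : A2.IsSymm :=
    (((hV _).add (hV _)).add ((hV _).neg.add (hV _).neg)).add (hA.submatrix _)
  have hhalf : (2 : Form m r) * MvPolynomial.C (1 / 2) = 1 := by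
    rw [show (2 : Form m r) = MvPolynomial.C 2 from rfl, ← MvPolynomial.C_mul]
    norm_num
  have hxf : linForm x = X_ (lft i) - X_ (rgt i) := linForm_diffVec _ _
  have hhf : linForm h = h_ := linForm_hVec
  have q1 : quadForm A1 = typeStep i (quadForm A) := by
    rw [hA1, typeStep, hn]
    simp only [quadForm_add, quadForm_neg, quadForm_vecMulVec, linForm_sub, linForm_add, hxf, hhf]
    linear_combination (-(X_ (lft i) - X_ (rgt i)) * linForm n - linForm n * h_) * hhalf
  have q2 : quadForm A2 = typeStep i (quadForm A) := by
    have hs := divDiff_spec i (quadForm A)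
    have hd : divDiff i (quadForm A) = linForm n + h_ := by
      rw [← hn, nu]
      ring
    rw [permForm_quadForm, ← hσ, hd] at hs
    rw [hA2, typeStep, hn]
    simp only [quadForm_add, quadForm_neg, quadForm_vecMulVec, linForm_add, hxf, hhf]
    linear_combination ((X_ (lft i) - X_ (rgt i)) * h_ - linForm n * h_) * hhalf - hs
  have h12 : A2 = A1 := quadForm_injOn s2 s1 (q2.trans q1.symm)
  rw [h12] at m2
  have key : HasMult τ (normOp τ i n f) A1 := by
    convert m1.add m2 using 1
    ext z
    rw [← coeffId_lin, ← coeffRefl_lin, lin_hVec, lin_diffVec]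
    rfl
  refine hasType_iff.mpr ⟨?_, A1, s1, q1.symm, ?_⟩
  · rw [hn]
    exact isMero_Cbar hτ hm i n
  · rw [hn]
    exact key.congr (Cbar_genericEq_normOp hτ i n f).symm

lemma hasType_diamond {τ : ℂ} (hτ : 0 < τ.im) {f : Fun m r} {Q : Form m r} (hf : HasType τ f Q)
    (L : List (Fin (m - 1))) (hL : ParamsFreeOfX L Q) :
    HasType τ (diamond τ L Q f) (diamondType L Q) := by
  induction L with
  | nil => exact hf
  | cons i L ih =>
    obtain ⟨hL, p, hp⟩ := hL
    exact hasType_Cbar hτ (ih hL) hp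

/-- A meromorphic function which is not generically zero has no zeros on some nonempty open set. -/
lemma exists_isOpen_ne_zero {f : Fun m r} (hf : IsMero f) (h0 : ¬ GenericEq f 0) :
    ∃ V : Set (Pt m r), IsOpen V ∧ V.Nonempty ∧ ∀ z ∈ V, f z ≠ 0 := by
  by_contra! hcon
  apply h0
  refine ⟨interior {z | f z = 0}, isOpen_interior, ?_, fun z hz => ?_⟩
  swap
  · exact interior_subset (s := {z | f z = 0}) hz
  by_contra hd
  obtain ⟨z, hz⟩ := not_forall.mp hd
  obtain ⟨p, q, hp, hq, hq0, h⟩ := hf z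
  have hW := isClosed_closure.isOpen_compl.mem_nhds hz
  -- a point `y` near `z` at which `f` is holomorphic
  obtain ⟨y, hqy, hy, hpy, hqay, hyW⟩ := ((Filter.not_eventually.mp hq0).and_eventually
    (h.eventually_nhds.and (hp.eventually_analyticAt.and (hq.eventually_analyticAt.and hW)))).exists
  have hfy : ∀ᶠ w in 𝓝 y, f w = p w / q w := by
    filter_upwards [hy, hqay.continuousAt.eventually_ne hqy] with w hw hw'
    exact hw hw'
  have hyn : ¬ ∀ᶠ w in 𝓝 y, f w = 0 := fun h' =>
    hyW (subset_closure (mem_interior_iff_mem_nhds.mpr h'))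
  -- a point `w` near `y` at which `f` is holomorphic and nonzero
  obtain ⟨w, hw0, hw, hpw, hqw, hqw0⟩ := ((Filter.not_eventually.mp hyn).and_eventually
    (hfy.eventually_nhds.and (hpy.eventually_analyticAt.and (hqay.eventually_analyticAt.and
      (hqay.continuousAt.eventually_ne hqy))))).exists
  have hne : ∀ᶠ v in 𝓝 w, f v ≠ 0 := by
    have hc : ContinuousAt (fun v => p v / q v) w := hpw.continuousAt.div hqw.continuousAt hqw0
    rw [hw.self_of_nhds] at hw0
    filter_upwards [hc.eventually_ne hw0, hw] with v hv hv'
    rw [hv']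
    exact hv
  obtain ⟨V, hV, hVo, hwV⟩ := mem_nhds_iff.mp hne
  obtain ⟨v, hv, hv0⟩ := hcon V hVo ⟨w, hwV⟩
  exact hV hv hv0

lemma hasType_unique {τ : ℂ} {f : Fun m r} {P Q : Form m r} (hP : HasType τ f P)
    (hQ : HasType τ f Q) (h0 : ¬ GenericEq f 0) : P = Q := by
  obtain ⟨hm, A, hA, rfl, hAm⟩ := hasType_iff.mp hP
  obtain ⟨-, B, hB, rfl, hBm⟩ := hasType_iff.mp hQ
  obtain ⟨V, hVo, hVn, hV⟩ := exists_isOpen_ne_zero hm h0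
  congr 1
  ext a b
  have h1 := hAm 0 (Pi.single a 1)
  have h2 := hBm 0 (Pi.single a 1)
  rw [genericEq_iff] at h1 h2
  obtain ⟨U, hUo, hUd, hU⟩ := h1.and h2
  obtain ⟨z, hzV, hzU⟩ := hUd.inter_open_nonempty V hVo hVn
  have hW : V ∩ U ∈ 𝓝 z := (hVo.inter hUo).mem_nhds ⟨hzV, hzU⟩
  have hmul : ∀ w ∈ V ∩ U, multiplier τ (A - B) 0 (Pi.single a 1) w = 1 := by
    rintro w ⟨hwV, hwU⟩
    obtain ⟨e1, e2⟩ := hU hwU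
    rw [sub_eq_add_neg, multiplier_add, multiplier_neg,
      mul_right_cancel₀ (hV w hwV) (e1.symm.trans e2), mul_inv_cancel₀ multiplier_ne_zero]
  -- the multiplier is an exponential function on the line through `z` in the direction `b`
  have hline : ∀ t : ℂ, multiplier τ (A - B) 0 (Pi.single a 1)
      (z + t • (Pi.single b 1 : Pt m r)) = multiplier τ (A - B) 0 (Pi.single a 1) z *
        Complex.exp (-(2 * Real.pi * Complex.I * ((A - B) a b : ℤ)) * t) := by
    intro t
    have hs : ∀ w : Pt m r, ∑ c, ∑ d, ((Pi.single a 1 : Var m r → ℤ) c : ℂ) *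
        ((A - B) c d : ℤ) * w d = ∑ d, ((A - B) a d : ℤ) * w d := by
      intro w
      rw [Finset.sum_eq_single a]
      · simp only [Pi.single_eq_same, Int.cast_one, one_mul]
      · intro c _ hc
        simp only [Pi.single_eq_of_ne hc, Int.cast_zero, zero_mul, Finset.sum_const_zero]
      · simp
    have hs' : ∑ d, ((A - B) a d : ℤ) * (z + t • (Pi.single b 1 : Pt m r)) d =
        ∑ d, ((A - B) a d : ℤ) * z d + ((A - B) a b : ℤ) * t := by
      simp only [Pi.add_apply, Pi.smul_apply, smul_eq_mul, mul_add, Finset.sum_add_distrib]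
      congr 1
      rw [Finset.sum_eq_single b]
      · simp
      · intro d _ hd
        simp [hd]
      · simp
    rw [multiplier, multiplier, hs, hs, hs', mul_assoc _ (Complex.exp _), ← Complex.exp_add]
    ring_nf
  have hc : Filter.Tendsto (fun t : ℂ => z + t • (Pi.single b 1 : Pt m r)) (𝓝 0) (𝓝 z) := by
    have : Continuous fun t : ℂ => z + t • (Pi.single b 1 : Pt m r) := by fun_prop
    simpa using this.tendsto 0
  have hexp : (fun t : ℂ => Complex.exp (-(2 * Real.pi * Complex.I * ((A - B) a b : ℤ)) * t))
      =ᶠ[𝓝 0] fun _ => 1 := by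
    filter_upwards [hc.eventually hW] with t ht
    have := hline t
    rw [hmul _ ht, hmul z ⟨hzV, hzU⟩, one_mul] at this
    exact this.symm
  have hder : HasDerivAt
      (fun t : ℂ => Complex.exp (-(2 * Real.pi * Complex.I * ((A - B) a b : ℤ)) * t))
      (-(2 * Real.pi * Complex.I * ((A - B) a b : ℤ))) 0 := by
    simpa using ((hasDerivAt_id (0 : ℂ)).const_mul
      (-(2 * Real.pi * Complex.I * ((A - B) a b : ℤ)))).cexp
  have h3 := hexp.deriv_eq
  rw [hder.deriv, deriv_const] at h3
  have hpi : (Real.pi : ℂ) ≠ 0 := by exact_mod_cast Real.pi_ne_zero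
  have h4 : (((A - B) a b : ℤ) : ℂ) = 0 := by
    simpa only [neg_eq_zero, mul_eq_zero, hpi, Complex.I_ne_zero, two_ne_zero, false_or]
      using h3
  have h5 : (A - B) a b = 0 := by exact_mod_cast h4
  exact sub_eq_zero.mp h5

/-! ### Unitarity, commutation and the braid relation -/

lemma simpleRefl_of_ne {i : Fin (m - 1)} {a : Fin m} (h1 : a.1 ≠ i.1) (h2 : a.1 ≠ i.1 + 1) :
    simpleRefl i a = a :=
  Equiv.swap_apply_of_ne_of_ne (fun h => h1 (congrArg Fin.val h)) (fun h => h2 (congrArg Fin.val h))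

lemma normOp_unitarity {τ : ℂ} (hτ : 0 < τ.im) {i : Fin (m - 1)} {n : Var m r → ℤ}
    (hn : ∀ j, n (Sum.inl j) = 0) (f : Fun m r) {z : Pt m r}
    (hx : thetaLin τ (diffVec (lft i) (rgt i)) z ≠ 0) (h1 : thetaLin τ (n + hVec m r) z ≠ 0)
    (h2 : thetaLin τ (-n + hVec m r) z ≠ 0) : normOp τ i (-n) (normOp τ i n f) z = f z := by
  rw [thetaLin, lin_diffVec] at hx
  rw [thetaLin, lin_add, lin_hVec] at h1 h2
  rw [lin_neg] at h2
  simp only [normOp, act_act, lin_act hn, lin_neg, act_inl, act_inr, simpleRefl_lft,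
    simpleRefl_rgt]
  rw [show z (Sum.inl (rgt i)) - z (Sum.inl (lft i)) =
    -(z (Sum.inl (lft i)) - z (Sum.inl (rgt i))) by ring]
  linear_combination f z * coeff_unitarity_id hτ hx h1 h2 + f (act i z) *
    coeff_unitarity_refl hτ (h := z (Sum.inr Par.h))
      (x := z (Sum.inl (lft i)) - z (Sum.inl (rgt i))) (ν := lin n z)

lemma normOp_comm {τ : ℂ} {i j : Fin (m - 1)} (hij : i.1 + 1 < j.1 ∨ j.1 + 1 < i.1)
    {n k : Var m r → ℤ} (hn : ∀ j, n (Sum.inl j) = 0) (hk : ∀ j, k (Sum.inl j) = 0)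
    (f : Fun m r) : normOp τ i n (normOp τ j k f) = normOp τ j k (normOp τ i n f) := by
  ext z
  have e1 : simpleRefl i (lft j) = lft j := simpleRefl_of_ne (by simp [lft]; omega)
    (by simp [lft]; omega)
  have e2 : simpleRefl i (rgt j) = rgt j := simpleRefl_of_ne (by simp [rgt]; omega)
    (by simp [rgt]; omega)
  have e3 : simpleRefl j (lft i) = lft i := simpleRefl_of_ne (by simp [lft]; omega)
    (by simp [lft]; omega)
  have e4 : simpleRefl j (rgt i) = rgt i := simpleRefl_of_ne (by simp [rgt]; omega)
    (by simp [rgt]; omega)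
  simp only [normOp, lin_act hn, lin_act hk, act_inl, act_inr, e1, e2, e3, e4, act_comm hij]
  ring

/-- The coefficients of the identity and of the two simple reflections are compared by the three-term
identity; those of the remaining three permutations agree term by term. -/
lemma normOp_braid {τ : ℂ} (hτ : 0 < τ.im) {i j : Fin (m - 1)} (hij : i.1 + 1 = j.1)
    {n k : Var m r → ℤ} (hn : ∀ j, n (Sum.inl j) = 0) (hk : ∀ j, k (Sum.inl j) = 0)
    (f : Fun m r) {z : Pt m r} (h1 : thetaLin τ (diffVec (lft i) (rgt i)) z ≠ 0)
    (h2 : thetaLin τ (diffVec (lft j) (rgt j)) z ≠ 0)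
    (h3 : thetaLin τ (diffVec (lft i) (rgt j)) z ≠ 0) :
    normOp τ i k (normOp τ j (n + k) (normOp τ i n f)) z =
      normOp τ j n (normOp τ i (n + k) (normOp τ j k f)) z := by
  have hnk : ∀ j, (n + k) (Sum.inl j) = 0 := fun j => by simp [hn, hk]
  have e : lft j = rgt i := Fin.ext hij.symm
  have e1 : simpleRefl i (rgt j) = rgt j := simpleRefl_of_ne (by simp [rgt]; omega)
    (by simp [rgt]; omega)
  have e2 : simpleRefl j (lft i) = lft i := simpleRefl_of_ne (by simp [lft]; omega)
    (by simp [lft]; omega)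
  have e3 : simpleRefl j (rgt i) = rgt j := by rw [← e, simpleRefl_lft]
  have e4 : simpleRefl j (rgt j) = rgt i := by rw [simpleRefl_rgt, e]
  rw [thetaLin, lin_diffVec] at h1 h2 h3
  simp only [normOp, lin_act hn, lin_act hk, lin_act hnk, act_inl, act_inr, e, e1, e2, e3, e4,
    simpleRefl_lft, simpleRefl_rgt, act_act, act_braid hij, lin_add] at h2 ⊢
  -- in terms of `x = x_1 - x_2` and `y = x_2 - x_3` for the three coordinates involved
  obtain ⟨x, hx⟩ : ∃ x, x = z (Sum.inl (lft i)) - z (Sum.inl (rgt i)) := ⟨_, rfl⟩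
  obtain ⟨y, hy⟩ : ∃ y, y = z (Sum.inl (rgt i)) - z (Sum.inl (rgt j)) := ⟨_, rfl⟩
  have hxy : z (Sum.inl (lft i)) - z (Sum.inl (rgt j)) = x + y := by rw [hx, hy]; ring
  have hx' : z (Sum.inl (rgt i)) - z (Sum.inl (lft i)) = -x := by rw [hx]; ring
  have hy' : z (Sum.inl (rgt j)) - z (Sum.inl (rgt i)) = -y := by rw [hy]; ring
  rw [hxy] at h3
  rw [← hx] at h1
  rw [← hy] at h2
  simp only [hxy, hx', hy', ← hx, ← hy]
  have b1 := coeff_braid_id hτ (h := z (Sum.inr Par.h)) (a := lin n z) (c := lin k z) h1 h2 h3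
  have b2 := coeff_braid_refl hτ (h := z (Sum.inr Par.h)) (a := lin n z) (c := lin k z) h1 h2 h3
  have b3 := coeff_braid_refl hτ (h := z (Sum.inr Par.h)) (a := lin k z) (c := lin n z) h2 h1
    (by rwa [add_comm])
  rw [add_comm (lin k z), add_comm y] at b3
  have c1 := coeffRefl_mul_comm (τ := τ) (h := z (Sum.inr Par.h)) (x := y) (y := x + y)
    (ν := lin n z + lin k z) (lin n z)
  have c2 := coeffRefl_mul_comm (τ := τ) (h := z (Sum.inr Par.h)) (x := x) (y := x + y)
    (ν := lin k z) (lin n z + lin k z)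
  linear_combination f z * b1 + f (act i z) * b2 - f (act j z) * b3 +
    coeffId τ (z (Sum.inr Par.h)) x (lin k z) * f (act i (act j z)) * c1 +
    coeffId τ (z (Sum.inr Par.h)) y (lin n z) * f (act j (act i z)) * c2

section Generic

variable {τ : ℂ} {i j : Fin (m - 1)} {n k : Var m r → ℤ}

lemma Cbar_unitarity (hτ : 0 < τ.im) (hn : ∀ j, n (Sum.inl j) = 0)
    (h1 : n + hVec m r ≠ 0) (h2 : -n + hVec m r ≠ 0) (f : Fun m r) :
    GenericEq (Cbar τ i (linForm (-n)) (Cbar τ i (linForm n) f)) f := by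
  refine (Cbar_genericEq_normOp hτ i (-n) _).trans
    ((normOp_congr (Cbar_genericEq_normOp hτ i n f) i (-n)).trans ?_)
  rw [genericEq_iff]
  filter_upwards [eventually_thetaLin_ne_zero hτ (diffVec_ne_zero (r := r) (lft_ne_rgt i)),
    eventually_thetaLin_ne_zero hτ h1, eventually_thetaLin_ne_zero hτ h2] with z a b c
  exact normOp_unitarity hτ hn f a b c

lemma Cbar_comm (hτ : 0 < τ.im) (hij : i.1 + 1 < j.1 ∨ j.1 + 1 < i.1)
    (hn : ∀ j, n (Sum.inl j) = 0) (hk : ∀ j, k (Sum.inl j) = 0) (f : Fun m r) :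
    GenericEq (Cbar τ i (linForm n) (Cbar τ j (linForm k) f))
      (Cbar τ j (linForm k) (Cbar τ i (linForm n) f)) := by
  refine (Cbar_genericEq_normOp hτ i n _).trans
    ((normOp_congr (Cbar_genericEq_normOp hτ j k f) i n).trans ?_)
  rw [normOp_comm hij hn hk]
  exact ((Cbar_genericEq_normOp hτ j k _).trans
    (normOp_congr (Cbar_genericEq_normOp hτ i n f) j k)).symm

lemma Cbar_triple_genericEq_normOp (hτ : 0 < τ.im) (i₁ i₂ i₃ : Fin (m - 1))
    (n₁ n₂ n₃ : Var m r → ℤ) (f : Fun m r) :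
    GenericEq (Cbar τ i₁ (linForm n₁) (Cbar τ i₂ (linForm n₂) (Cbar τ i₃ (linForm n₃) f)))
      (normOp τ i₁ n₁ (normOp τ i₂ n₂ (normOp τ i₃ n₃ f))) :=
  (Cbar_genericEq_normOp hτ i₁ n₁ _).trans (normOp_congr ((Cbar_genericEq_normOp hτ i₂ n₂ _).trans
    (normOp_congr (Cbar_genericEq_normOp hτ i₃ n₃ f) i₂ n₂)) i₁ n₁)

lemma Cbar_braid (hτ : 0 < τ.im) (hij : i.1 + 1 = j.1 ∨ j.1 + 1 = i.1)
    (hn : ∀ j, n (Sum.inl j) = 0) (hk : ∀ j, k (Sum.inl j) = 0) (f : Fun m r) :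
    GenericEq (Cbar τ i (linForm k) (Cbar τ j (linForm (n + k)) (Cbar τ i (linForm n) f)))
      (Cbar τ j (linForm n) (Cbar τ i (linForm (n + k)) (Cbar τ j (linForm k) f))) := by
  -- the two orientations of the relation differ by reading it backwards
  wlog h : i.1 + 1 = j.1 generalizing i j n k
  · rw [add_comm n k]
    exact (this hij.symm hk hn (hij.resolve_left h)).symm
  refine (Cbar_triple_genericEq_normOp hτ _ _ _ _ _ _ f).trans
    (GenericEq.trans ?_ (Cbar_triple_genericEq_normOp hτ _ _ _ _ _ _ f).symm)
  have hne : lft i ≠ rgt j := by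
    simp only [lft, rgt, ne_eq, Fin.mk.injEq]
    omega
  rw [genericEq_iff]
  filter_upwards [eventually_thetaLin_ne_zero hτ (diffVec_ne_zero (r := r) (lft_ne_rgt i)),
    eventually_thetaLin_ne_zero hτ (diffVec_ne_zero (r := r) (lft_ne_rgt j)),
    eventually_thetaLin_ne_zero hτ (diffVec_ne_zero (r := r) hne)] with z a b c
  exact normOp_braid hτ h hn hk f a b c

end Generic

/-! ### Independence of the word -/

lemma exists_nu_eq_linForm_of_hasType {τ : ℂ} {f : Fun m r} {Q : Form m r} (hf : HasType τ f Q)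
    {i : Fin (m - 1)} {p : MvPolynomial (Par r) ℚ} (hp : nu i Q = ofPar p) :
    ∃ n : Var m r → ℤ, (∀ j, n (Sum.inl j) = 0) ∧ nu i Q = linForm n := by
  obtain ⟨-, A, hA, rfl, -⟩ := hasType_iff.mp hf
  exact exists_nu_eq_linForm hA hp

/-- Reductions preserve the hypotheses on a word and the result of its operations. A braid move
permutes the three parameters `ν`, `ν + ν'`, `ν'`, so that the new word is defined if the old one
is. -/
lemma Reduces.diamond_genericEq {τ : ℂ} (hτ : 0 < τ.im) {L M : List (Fin (m - 1))}
    (h : Reduces L M) {f : Fun m r} {Q : Form m r} (hf : HasType τ f Q)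
    (hN : Nonsingular L Q) (hP : ParamsFreeOfX L Q) :
    Nonsingular M Q ∧ ParamsFreeOfX M Q ∧ diamondType L Q = diamondType M Q ∧
      GenericEq (diamond τ L Q f) (diamond τ M Q f) := by
  induction h with
  | refl L => exact ⟨hN, hP, rfl, .refl _⟩
  | trans _ _ h1 h2 =>
    obtain ⟨a1, a2, a3, a4⟩ := h1 hN hP
    obtain ⟨b1, b2, b3, b4⟩ := h2 a1 a2
    exact ⟨b1, b2, a3.trans b3, a4.trans b4⟩
  | cons i _ ih =>
    obtain ⟨a1, a2, a3, a4⟩ := ih hN.1 hP.1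
    obtain ⟨-, hN⟩ := hN
    obtain ⟨-, hP⟩ := hP
    refine ⟨⟨a1, a3 ▸ hN⟩, ⟨a2, a3 ▸ hP⟩, ?_, ?_⟩
    · simp only [diamondType, a3]
    · simp only [diamond, a3]
      exact Cbar_congr a4 _ _
  | cancel i L =>
    obtain ⟨⟨hN, hN1⟩, hN2⟩ := hN
    obtain ⟨⟨hP, p, hp⟩, -⟩ := hP
    obtain ⟨n, hn, hnu⟩ := exists_nu_eq_linForm_of_hasType (hasType_diamond hτ hf L hP) hp
    have hnu2 := nu_typeStep_self hp
    have hnu2' := hnu2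
    simp only [diamondType] at hN2
    rw [hnu, ← linForm_neg] at hnu2
    rw [hnu2, ← linForm_hVec, ← linForm_add, linForm_ne_zero] at hN2
    rw [hnu, ← linForm_hVec, ← linForm_add, linForm_ne_zero] at hN1
    refine ⟨hN, hP, ?_, ?_⟩
    · simp only [diamondType]
      rw [typeStep, hnu2', typeStep]
      ring
    · simp only [diamond, diamondType, hnu2, hnu]
      exact Cbar_unitarity hτ hn hN1 hN2 _
  | comm i j L hij =>
    obtain ⟨⟨hN, hN1⟩, hN2⟩ := hN
    obtain ⟨⟨hP, p, hp⟩, q, hq⟩ := hP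
    simp only [diamondType] at hN2 hq
    have hj := nu_typeStep_comm hij hp
    rw [hj] at hN2 hq
    have hi := nu_typeStep_comm hij.symm hq
    have hf' := hasType_diamond hτ hf L hP
    obtain ⟨n, hn, hnu⟩ := exists_nu_eq_linForm_of_hasType hf' hp
    obtain ⟨k, hk, hku⟩ := exists_nu_eq_linForm_of_hasType hf' hq
    refine ⟨⟨⟨hN, hN2⟩, ?_⟩, ⟨⟨hP, q, hq⟩, p, ?_⟩, ?_, ?_⟩
    · simpa only [diamondType, hi] using hN1
    · simpa only [diamondType, hi] using hp
    · simp only [diamondType]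
      rw [typeStep, hj, typeStep, typeStep, hi, typeStep]
      ring
    · simp only [diamond, diamondType, hi, hj, hnu, hku]
      exact Cbar_comm hτ hij hk hn _
  | braid i j L hij =>
    obtain ⟨⟨⟨hN, hN1⟩, hN2⟩, hN3⟩ := hN
    obtain ⟨⟨⟨hP, p, hp⟩, q, hq⟩, s, hs⟩ := hP
    simp only [diamondType] at hN2 hN3 hq hs
    set P := diamondType L Q with hPdef
    have hj := nu_typeStep_adjacent hij.symm hp
    have hi : nu i (typeStep j (typeStep i P)) = nu j P := by
      rw [nu_typeStep_adjacent hij hq, nu_typeStep_self hp, hj]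
      ring
    rw [hj] at hN2 hq
    rw [hi] at hN3 hs
    have hi' := nu_typeStep_adjacent hij hs
    have hq' : nu i (typeStep j P) = ofPar q := by rw [hi', add_comm, hq]
    have hj' : nu j (typeStep i (typeStep j P)) = nu i P := by
      rw [nu_typeStep_adjacent hij.symm hq', nu_typeStep_self hs, hi']
      ring
    have hf' := hasType_diamond hτ hf L hP
    obtain ⟨n, hn, hnu⟩ := exists_nu_eq_linForm_of_hasType hf' hp
    obtain ⟨k, hk, hku⟩ := exists_nu_eq_linForm_of_hasType hf' hs
    rw [← hPdef] at hnu hku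
    refine ⟨⟨⟨⟨hN, hN3⟩, ?_⟩, ?_⟩, ⟨⟨⟨hP, s, hs⟩, q, ?_⟩, p, ?_⟩, ?_, ?_⟩
    · simpa only [diamondType, ← hPdef, hi', add_comm (nu i P)] using hN2
    · simpa only [diamondType, ← hPdef, hj'] using hN1
    · simpa only [diamondType, ← hPdef] using hq'
    · simpa only [diamondType, ← hPdef, hj'] using hp
    · simp only [diamondType, ← hPdef]
      rw [typeStep, hi, typeStep, hj, typeStep, typeStep, hj', typeStep, hi', typeStep]
      ring
    · simp only [diamond, diamondType, ← hPdef, hi, hj, hi', hj']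
      rw [hnu, hku, add_comm (linForm k), ← linForm_add]
      exact Cbar_braid hτ hij hn hk _

/-! ### The type of the result -/

/-- `φ_w(α) = ∑ (w(a) - a) α_a`: the number of inversions in which `a` comes first minus the number
of those in which it comes second is `w(a) - a`. -/
lemma phi_eq_sum {M : Type*} [AddCommGroup M] (w : Equiv.Perm (Fin m)) (α : Fin m → M) :
    phi w α = ∑ a, (((w a).1 : ℤ) - (a.1 : ℤ)) • α a := by
  have h1 : ∀ a : Fin m, (((w a).1 : ℤ) - (a.1 : ℤ)) =
      ∑ b, ((if a < b ∧ w b < w a then (1 : ℤ) else 0) - if b < a ∧ w a < w b then 1 else 0) := by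
    intro a
    have e1 : ((w a).1 : ℤ) = ∑ b, if w b < w a then (1 : ℤ) else 0 := by
      rw [Equiv.sum_comp w (fun b => if b < w a then (1 : ℤ) else 0), Finset.sum_boole,
        Finset.filter_gt_eq_Iio, Fin.card_Iio]
    have e2 : (a.1 : ℤ) = ∑ b, if b < a then (1 : ℤ) else 0 := by
      rw [Finset.sum_boole, Finset.filter_gt_eq_Iio, Fin.card_Iio]
    rw [e1, e2, ← Finset.sum_sub_distrib]
    refine Finset.sum_congr rfl fun b _ => ?_
    rcases lt_trichotomy a b with h | h | h
    · simp [h, h.not_gt]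
    · simp [h]
    · rcases lt_trichotomy (w a) (w b) with h' | h' | h'
      · simp [h, h.not_gt, h', h'.not_gt]
      · exact absurd (w.injective h') h.ne'
      · simp [h, h.not_gt, h', h'.not_gt]
  simp only [h1, Finset.sum_smul, sub_smul, Finset.sum_sub_distrib]
  rw [Finset.sum_comm (f := fun a b => (if b < a ∧ w a < w b then (1 : ℤ) else 0) • α a)]
  rw [phi, Finset.sum_filter, Fintype.sum_prod_type]
  simp only [← Finset.sum_sub_distrib, ite_smul, one_smul, zero_smul]
  refine Finset.sum_congr rfl fun a _ => Finset.sum_congr rfl fun b _ => ?_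
  split_ifs <;> simp

/-- The form `w(q_x) + ρ h + q_μ - φ_w(q_x) h`, where `q_x = ∑ α_i x_i`. -/
def resultType (α : Fin m → MvPolynomial (Par r) ℚ) (q : MvPolynomial (Par r) ℚ)
    (w : Equiv.Perm (Fin m)) : Form m r :=
  permForm w (∑ i, ofPar (α i) * X_ i) + rho * h_ + ofPar q - ofPar (phi w α) * h_

lemma permForm_sum (w : Equiv.Perm (Fin m)) (α : Fin m → MvPolynomial (Par r) ℚ) :
    permForm w (∑ i, ofPar (α i) * X_ i : Form m r) = ∑ i, ofPar (α (w⁻¹ i)) * X_ i := by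
  rw [permForm, map_sum, ← Equiv.sum_comp w fun i => (ofPar (α (w⁻¹ i)) * X_ i : Form m r)]
  refine Finset.sum_congr rfl fun i _ => ?_
  rw [← permForm, permForm_mul, permForm_ofPar, permForm_X,
    show w⁻¹ (w i) = i from w.symm_apply_apply i]

lemma sum_sub_swap (i : Fin (m - 1)) (β : Fin m → MvPolynomial (Par r) ℚ) :
    (∑ j, ofPar (β j) * X_ j : Form m r) - ∑ j, ofPar (β (simpleRefl i j)) * X_ j =
      (X_ (lft i) - X_ (rgt i)) * ofPar (β (lft i) - β (rgt i)) := by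
  rw [← Finset.sum_sub_distrib, Finset.sum_eq_add (lft i) (rgt i) (lft_ne_rgt i)]
  · rw [simpleRefl_lft, simpleRefl_rgt, ofPar_sub]
    ring
  · intro j _ hj
    rw [show simpleRefl i j = j from Equiv.swap_apply_of_ne_of_ne hj.1 hj.2, sub_self]
  · simp
  · simp

lemma rho_eq_sum : (rho : Form m r) =
    ∑ j : Fin m, ofPar (-((j.1 : MvPolynomial (Par r) ℚ) + 1)) * X_ j := by
  rw [rho, ← Finset.sum_neg_distrib]
  refine Finset.sum_congr rfl fun j _ => ?_
  simp only [ofPar, map_neg, map_add, map_natCast, map_one, neg_mul]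

lemma rho_sub_permForm (i : Fin (m - 1)) :
    (rho : Form m r) - permForm (simpleRefl i) rho = X_ (lft i) - X_ (rgt i) := by
  have h := sum_sub_swap (r := r) i (fun j => -((j.1 : MvPolynomial (Par r) ℚ) + 1))
  rw [rho_eq_sum, permForm_sum, simpleRefl, Equiv.swap_inv, ← simpleRefl, h]
  simp [lft, rgt, ofPar]

lemma nu_resultType (i : Fin (m - 1)) (α : Fin m → MvPolynomial (Par r) ℚ)
    (q : MvPolynomial (Par r) ℚ) (w : Equiv.Perm (Fin m)) :
    nu i (resultType α q w) = ofPar (α (w⁻¹ (lft i)) - α (w⁻¹ (rgt i))) := by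
  have h1 := sum_sub_swap i fun j => α (w⁻¹ j)
  have h2 := permForm_sum (simpleRefl i) fun j => α (w⁻¹ j)
  rw [show (simpleRefl i)⁻¹ = simpleRefl i from Equiv.swap_inv _ _] at h2
  have h : divDiff i (resultType α q w) = ofPar (α (w⁻¹ (lft i)) - α (w⁻¹ (rgt i))) + h_ := by
    apply divDiff_eq_of_mul
    rw [resultType, permForm_sum, h_eq_ofPar]
    simp only [permForm_add, permForm_sub, permForm_mul, permForm_ofPar]
    rw [h2]
    linear_combination h1 + ofPar (MvPolynomial.X Par.h) * rho_sub_permForm (r := r) i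
  rw [nu, h, add_sub_cancel_right]

lemma phi_simpleRefl_mul (i : Fin (m - 1)) (w : Equiv.Perm (Fin m))
    (α : Fin m → MvPolynomial (Par r) ℚ) :
    phi (simpleRefl i * w) α = phi w α + (α (w⁻¹ (lft i)) - α (w⁻¹ (rgt i))) := by
  rw [← sub_eq_iff_eq_add', phi_eq_sum, phi_eq_sum, ← Finset.sum_sub_distrib]
  simp only [← sub_smul, sub_sub_sub_cancel_right, Equiv.Perm.mul_apply]
  have h := Equiv.sum_comp w fun b =>
    ((((simpleRefl i b).1 : ℤ) - (b.1 : ℤ)) • α (w⁻¹ b))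
  simp only [show ∀ b, w⁻¹ (w b) = b from w.symm_apply_apply] at h
  rw [h, Finset.sum_eq_add (lft i) (rgt i) (lft_ne_rgt i)]
  · rw [simpleRefl_lft, simpleRefl_rgt]
    simp [lft, rgt, sub_eq_add_neg]
  · intro j _ hj
    rw [show simpleRefl i j = j from Equiv.swap_apply_of_ne_of_ne hj.1 hj.2, sub_self, zero_smul]
  · simp
  · simp

lemma typeStep_resultType (i : Fin (m - 1)) (α : Fin m → MvPolynomial (Par r) ℚ)
    (q : MvPolynomial (Par r) ℚ) (w : Equiv.Perm (Fin m)) :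
    typeStep i (resultType α q w) = resultType α q (simpleRefl i * w) := by
  have h1 := sum_sub_swap i fun j => α (w⁻¹ j)
  rw [typeStep, nu_resultType, resultType, resultType, permForm_sum, permForm_sum,
    phi_simpleRefl_mul, ofPar_add]
  simp only [mul_inv_rev, Equiv.Perm.mul_apply,
    show (simpleRefl i)⁻¹ = simpleRefl i from Equiv.swap_inv _ _]
  linear_combination h1

lemma phi_one {M : Type*} [AddCommGroup M] (α : Fin m → M) : phi 1 α = 0 := by
  simp [phi_eq_sum]

lemma diamondType_eq_resultType (L : List (Fin (m - 1))) (α : Fin m → MvPolynomial (Par r) ℚ)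
    (q : MvPolynomial (Par r) ℚ) :
    diamondType L ((∑ i, ofPar (α i) * X_ i) + rho * h_ + ofPar q) =
      resultType α q (wordProd L) := by
  induction L with
  | nil =>
    rw [diamondType, wordProd_nil, resultType, phi_one, permForm_sum]
    simp [ofPar]
  | cons i L ih => rw [diamondType, ih, typeStep_resultType, wordProd_cons]

lemma paramsFreeOfX_of_eq (L : List (Fin (m - 1))) (α : Fin m → MvPolynomial (Par r) ℚ)
    (q : MvPolynomial (Par r) ℚ) :
    ParamsFreeOfX L ((∑ i, ofPar (α i) * X_ i) + rho * h_ + ofPar q) := by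
  induction L with
  | nil => trivial
  | cons i L ih => exact ⟨ih, _, by rw [diamondType_eq_resultType, nu_resultType]⟩

end EllipticDemazure

end

open EllipticDemazure in
theorem mainTheorem2 (m r : ℕ) (τ : ℂ) (hτ : 0 < τ.im)
    (f : Fun m r) (Q : Form m r) (hf : HasType τ f Q) :
    -- every composition is pure of the type `diamondType L Q`; so are all its final segments,
    -- hence the parameters are `∂ type - h` for the actual types of the intermediate functions
    (∀ L : List (Fin (m - 1)), Nonsingular L Q → ParamsFreeOfX L Q →
      HasType τ (diamond τ L Q f) (diamondType L Q) ∧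
      (¬ GenericEq (diamond τ L Q f) 0 →
        ∀ P : Form m r, HasType τ (diamond τ L Q f) P → P = diamondType L Q)) ∧
    -- the result depends only on the permutation
    (∀ L L' : List (Fin (m - 1)), wordProd L = wordProd L' →
      Nonsingular L Q → ParamsFreeOfX L Q → Nonsingular L' Q → ParamsFreeOfX L' Q →
      GenericEq (diamond τ L Q f) (diamond τ L' Q f)) ∧
    -- the type of the result
    (∀ (α : Fin m → MvPolynomial (Par r) ℚ) (q_mu : MvPolynomial (Par r) ℚ),
      Q = (∑ i, ofPar (α i) * X_ i) + rho * h_ + ofPar q_mu →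
      ∀ (w : Equiv.Perm (Fin m)) (L : List (Fin (m - 1))), wordProd L = w →
        Nonsingular L Q →
        ParamsFreeOfX L Q ∧
        diamondType L Q = permForm w (∑ i, ofPar (α i) * X_ i) + rho * h_ + ofPar q_mu
          - ofPar (phi w α) * h_ ∧
        HasType τ (diamond τ L Q f)
          (permForm w (∑ i, ofPar (α i) * X_ i) + rho * h_ + ofPar q_mu
            - ofPar (phi w α) * h_)) := by
  refine ⟨fun L _ hP => ⟨hasType_diamond hτ hf L hP, fun h0 P h => ?_⟩,
    fun L L' h hN hP hN' hP' => ?_, ?_⟩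
  · exact hasType_unique h (hasType_diamond hτ hf L hP) h0
  · obtain ⟨M, hM, hM'⟩ := exists_common_reduction h
    exact (hM.diamond_genericEq hτ hf hN hP).2.2.2.trans
      (hM'.diamond_genericEq hτ hf hN' hP').2.2.2.symm
  · rintro α q rfl w L rfl _
    have hP := paramsFreeOfX_of_eq L α q
    have hT := diamondType_eq_resultType L α q
    have h := hasType_diamond hτ hf L hP
    rw [hT] at h
    exact ⟨hP, hT, h⟩
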